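/- **Theorem 3.2.** There are universal constants $K_1,K_2>0$ with the following property. Let $0<\varepsilon\le 1$ and let $c_0$ be a non-negative measurable function on $(0,\infty)$ with $$\int_0^\infty (1+x^{4/3})\,c_0(x)\,dx=M_0<\infty .$$ Let $c_\varepsilon(x,t)\ge 0$, $L_\varepsilon(t)>0$ be a solution, with initial data $c_\varepsilon(\cdot,0)=c_0$, of the diffusive LSW system with excess mass normalized to $1$: $$\frac{\partial c_\varepsilon}{\partial t}=\frac{\partial^2}{\partial x^2}\Big[\varepsilon\Big(1+\frac{x}{\varepsilon}\Big)^{1/3}c_\varepsilon\Big]+\frac{\partial}{\partial x}\Big[\Big\{1-\Big(\frac{x}{L_\varepsilon(t)}\Big)^{1/3}\Big\}c_\varepsilon\Big]\quad (x,t>0),$$ $$c_\varepsilon(0,t)=0\quad(t>0),\qquad \int_0^\infty x\,c_\varepsilon(x,t)\,dx=1\quad (t\ge 0).$$ Here $L_\varepsilon$ is continuous on $[0,\infty)$, $(1+x)c_\varepsilon(x,t)$ is integrable over $x\in(0,\infty)$ for every $t\ge0$ and over $(x,t)\in(0,\infty)\times(0,T)$ for every $T>0$, and the equation with its boundary and initial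 conditions holds in the weak sense: for every $t\ge0$ and every $\varphi\in C_c^\infty(\mathbb R)$ with $\varphi(0)=0$, $$\int_0^\infty\!\varphi\,c_\varepsilon(x,t)\,dx-\int_0^\infty\!\varphi\,c_0\,dx=\int_0^t\!\int_0^\infty\Big[\varepsilon\Big(1+\frac x\varepsilon\Big)^{1/3}\varphi''-\Big\{1-\Big(\frac{x}{L_\varepsilon(s)}\Big)^{1/3}\Big\}\varphi'\Big]c_\varepsilon(x,s)\,dx\,ds .$$ Put $E_\varepsilon(t)=\int_0^\infty x^{2/3}c_\varepsilon(x,t)\,dx$. Then for every $T\ge K_2M_0^3$ the function $E_\varepsilon^2$ is integrable on $[0,T]$ and $$\Big[\frac1T\int_0^T E_\varepsilon(t)^2\,dt\Big]^{-3/2}\le K_1T .$$ The constants do not depend on $\varepsilon$, $c_0$, $M_0$, $c_\varepsilon$ or $T$. -/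

import Mathlib

open MeasureTheory Set
open scoped ContDiff

/-- The spatial operator in duality form: for a test function `φ`,
`ε (1 + x/ε)^{1/3} φ''(x) - (1 - (x/ℓ)^{1/3}) φ'(x)`. It is the formal adjoint of
`c ↦ ∂²/∂x² [ε (1 + x/ε)^{1/3} c] + ∂/∂x [(1 - (x/ℓ)^{1/3}) c]`. -/
noncomputable def lswAdjoint (ε ℓ : ℝ) (φ : ℝ → ℝ) (x : ℝ) : ℝ :=
  ε * (1 + x / ε) ^ (1 / 3 : ℝ) * deriv (deriv φ) x
    - (1 - (x / ℓ) ^ (1 / 3 : ℝ)) * deriv φ x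

/-- `c x t` (cluster density at volume `x > 0` and time `t ≥ 0`), together with the parameter
`L t`, is a non-negative weak solution with total mass `m` and initial data `c₀` of

`∂c/∂t = ∂²/∂x² [ε (1 + x/ε)^{1/3} c] + ∂/∂x [(1 - (x/L(t))^{1/3}) c]`, for `x > 0`, `t > 0`,
`c(0,t) = 0` for `t > 0`, and `∫₀^∞ x c(x,t) dx = m` for `t ≥ 0`.

The test functions are smooth with bounded support in `[0,∞)`, and vanish at `x = 0`; their
derivative at `0` is unrestricted. This encodes the Dirichlet condition: for a density that is
continuous up to `x = 0`, the boundary term left by the two integrations by parts is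
`ε φ'(0) c(0,t)`. No formula for `L` is imposed; it is determined by conservation of mass. -/
structure IsDiffusiveLSWSolution (ε m : ℝ) (c₀ : ℝ → ℝ) (c : ℝ → ℝ → ℝ) (L : ℝ → ℝ) :
    Prop where
  continuousOn_L : ContinuousOn L (Ici 0)
  L_pos : ∀ t, 0 ≤ t → 0 < L t
  nonneg : ∀ t, 0 ≤ t → ∀ x, 0 < x → 0 ≤ c x t
  initial : ∀ x, 0 < x → c x 0 = c₀ x
  /-- finite number and mass of clusters at each time -/
  integrable_slice : ∀ t, 0 ≤ t → IntegrableOn (fun x => (1 + x) * c x t) (Ioi 0)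
  /-- joint measurability, and integrability over bounded time intervals -/
  integrable_prod : ∀ T, 0 < T →
    IntegrableOn (fun p : ℝ × ℝ => (1 + p.1) * c p.1 p.2) (Ioi 0 ×ˢ Ioo 0 T)
  /-- conservation of mass -/
  mass : ∀ t, 0 ≤ t → ∫ x in Ioi 0, x * c x t = m
  /-- the evolution equation, tested on the time interval `[0,t]` -/
  weak_eq : ∀ φ : ℝ → ℝ, ContDiff ℝ ∞ φ → HasCompactSupport φ → φ 0 = 0 → ∀ t, 0 ≤ t →
    (∫ x in Ioi 0, φ x * c x t) - (∫ x in Ioi 0, φ x * c₀ x)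
      = ∫ s in (0 : ℝ)..t, ∫ x in Ioi 0, lswAdjoint ε (L s) φ x * c x s

/-- The energy `E(t) = ∫₀^∞ x^{2/3} c(x,t) dx`. -/
noncomputable def lswEnergy (c : ℝ → ℝ → ℝ) (t : ℝ) : ℝ :=
  ∫ x in Ioi 0, x ^ (2 / 3 : ℝ) * c x t

/-!
The argument is a Kohn–Otto interpolation argument between the energy `E = ∫ x^{2/3} c`, the
mass `∫ x c = 1` and the moment `H = ∫ x^{4/3} c`.

Write `u = x^{1/3}`, `v = L^{1/3}` and `a = ε (1 + x/ε)^{1/3}`. Conservation of mass says that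
`∫ (1 - u/v) c dx = 0` at almost every time, and with it the energy identity becomes,
formally, `-E' = D`, where `D = ∫ [(2/9) a x^{-4/3} + (2/3) (1 - u/v)² / u] c dx ≥ 0`. On the
other hand `H' = ∫ [(4/9) a x^{-2/3} - (4/3) (1 - u/v) u] c dx`, which by Young's inequality and
`∫ u³ c = 1` is at most `2 (D/κ + D + κ)` for every `κ > 0` (`lswGen_truncMoment_le`; `ε ≤ 1`
enters through `a ≤ 1 + x`). Choose `κ = 8 E²`. Since `D = -E'`, one has `∫₀ᵀ D/E² ≤ 2/E(T)`
(`lintegral_div_sq_le`), so `H(T) ≤ C M₀ + 1/(2E(T)) + 16 ∫₀ᵀ E²` (`truncMoment_growth`).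
By interpolation `1 ≤ E H` (`inv_energy_le_of_truncMoment_le` has the form used), hence
`1/(2E(T)) ≤ 8 M₀ + 16 ∫₀ᵀ E²`. As `E` decreases, also `∫₀ᵀ E² ≥ T E(T)²`. If `T ≥ M₀³`, either
of the two terms on the right being dominant gives `(∫₀ᵀ E²)³ ≥ T / 2³⁰`
(`le_cube_of_bounds`), which is the claim.

The powers `x^{2/3}` and `x^{4/3}` are not admissible test functions. The weak equation is first
extended to smooth functions with two bounded derivatives on `(0,∞)`
(`IsDiffusiveLSWSolution.weak_eq_of_lipschitz`). The first power is replaced by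
`(x + δ)^{2/3} - δ^{2/3}`, and Fatou's lemma with `δ → 0` gives `∫_s^T D ≤ E(s)`
(`lintegral_dissipation_le`); this and the monotonicity of `E` are all that is needed of the energy
identity. The second is replaced by `f = (1 + x)^{4/3} - 1 - (4/3) x`, truncated as `R f / (R + f)`:
this truncation lowers both `f'` and `f''`, so the bounds are uniform in `R`.
-/

/-! ### Integrability on time slices and space-time strips -/

/-- The operator `lswAdjoint`, with the first and second derivatives of the test function
given as separate arguments `g₁` and `g₂`. -/
noncomputable def lswGen (ε ℓ : ℝ) (g₁ g₂ : ℝ → ℝ) (x : ℝ) : ℝ :=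
  ε * (1 + x / ε) ^ (1 / 3 : ℝ) * g₂ x - (1 - (x / ℓ) ^ (1 / 3 : ℝ)) * g₁ x

/-- Lebesgue measure on the space-time strip `(0,∞) × (s,t]`. -/
noncomputable def stripMeasure (s t : ℝ) : Measure (ℝ × ℝ) :=
  (volume.restrict (Ioi 0)).prod (volume.restrict (Ioc s t))

theorem stripMeasure_eq (s t : ℝ) :
    stripMeasure s t = (volume : Measure (ℝ × ℝ)).restrict (Ioi 0 ×ˢ Ioc s t) := by
  rw [stripMeasure, Measure.prod_restrict, Measure.volume_eq_prod]

theorem ae_stripMeasure_mem (s t : ℝ) :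
    ∀ᵐ p ∂(stripMeasure s t), 0 < p.1 ∧ p.2 ∈ Ioc s t := by
  rw [stripMeasure_eq]
  filter_upwards [ae_restrict_mem (measurableSet_Ioi.prod measurableSet_Ioc)] with p hp
  exact hp

theorem diffusion_nonneg {ε x : ℝ} (hε : 0 < ε) (hx : 0 < x) :
    0 ≤ ε * (1 + x / ε) ^ (1 / 3 : ℝ) := by positivity

theorem diffusion_le {ε x : ℝ} (hε : 0 < ε) (hε1 : ε ≤ 1) (hx : 0 < x) :
    ε * (1 + x / ε) ^ (1 / 3 : ℝ) ≤ 1 + x := by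
  have h1 : (1 + x / ε) ^ (1 / 3 : ℝ) ≤ (1 + x / ε) ^ (1 : ℝ) :=
    Real.rpow_le_rpow_of_exponent_le (by have := div_pos hx hε; linarith) (by norm_num)
  rw [Real.rpow_one] at h1
  calc ε * (1 + x / ε) ^ (1 / 3 : ℝ) ≤ ε * (1 + x / ε) := by gcongr
    _ = ε + x := by field_simp
    _ ≤ 1 + x := by linarith

theorem rpow_third_le {y : ℝ} (hy : 0 ≤ y) : y ^ (1 / 3 : ℝ) ≤ 1 + y := by
  calc y ^ (1 / 3 : ℝ) ≤ (1 + y) ^ (1 / 3 : ℝ) := by gcongr; linarith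
    _ ≤ (1 + y) ^ (1 : ℝ) := Real.rpow_le_rpow_of_exponent_le (by linarith) (by norm_num)
    _ = 1 + y := Real.rpow_one _

theorem abs_lswGen_le {ε ℓ ℓ₀ K x : ℝ} {g₁ g₂ : ℝ → ℝ} (hε : 0 < ε) (hε1 : ε ≤ 1)
    (hℓ₀ : 0 < ℓ₀) (hℓ : ℓ₀ ≤ ℓ) (hx : 0 < x) (h₁ : |g₁ x| ≤ K) (h₂ : |g₂ x| ≤ K) :
    |lswGen ε ℓ g₁ g₂ x| ≤ (3 + 1 / ℓ₀) * K * (1 + x) := by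
  have hK : 0 ≤ K := (abs_nonneg _).trans h₁
  have hℓp := hℓ₀.trans_le hℓ
  have hq : 0 ≤ (x / ℓ) ^ (1 / 3 : ℝ) := by positivity
  have hq' : (x / ℓ) ^ (1 / 3 : ℝ) ≤ 1 + x / ℓ₀ := by
    refine (rpow_third_le (by positivity)).trans ?_
    gcongr
  have hd : |1 - (x / ℓ) ^ (1 / 3 : ℝ)| ≤ 2 + x / ℓ₀ := by
    rw [abs_le]
    have : 0 < x / ℓ₀ := by positivity
    constructor <;> linarith
  have ha := diffusion_nonneg hε hx
  calc |lswGen ε ℓ g₁ g₂ x|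
      ≤ |ε * (1 + x / ε) ^ (1 / 3 : ℝ) * g₂ x| + |(1 - (x / ℓ) ^ (1 / 3 : ℝ)) * g₁ x| :=
        abs_sub _ _
    _ = ε * (1 + x / ε) ^ (1 / 3 : ℝ) * |g₂ x| + |1 - (x / ℓ) ^ (1 / 3 : ℝ)| * |g₁ x| := by
        rw [abs_mul (ε * _), abs_mul (1 - _), abs_of_nonneg ha]
    _ ≤ (1 + x) * K + (2 + x / ℓ₀) * K := by
        gcongr
        exact diffusion_le hε hε1 hx
    _ ≤ (3 + 1 / ℓ₀) * K * (1 + x) := by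
        have : 0 < 1 / ℓ₀ := by positivity
        have e : (3 + 1 / ℓ₀) * K * (1 + x) - ((1 + x) * K + (2 + x / ℓ₀) * K)
            = K * (2 * x + 1 / ℓ₀) := by ring
        have : 0 ≤ K * (2 * x + 1 / ℓ₀) := by positivity
        linarith

namespace IsDiffusiveLSWSolution

variable {ε m : ℝ} {c₀ : ℝ → ℝ} {c : ℝ → ℝ → ℝ} {L : ℝ → ℝ}

theorem aestronglyMeasurable_slice (h : IsDiffusiveLSWSolution ε m c₀ c L) {t : ℝ} (ht : 0 ≤ t) :
    AEStronglyMeasurable (fun x => c x t) (volume.restrict (Ioi 0)) := by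
  have h1 : AEStronglyMeasurable (fun x : ℝ => (1 + x)⁻¹ * ((1 + x) * c x t))
      (volume.restrict (Ioi 0)) :=
    (Measurable.aestronglyMeasurable (by fun_prop)).mul (h.integrable_slice t ht).1
  refine h1.congr ?_
  filter_upwards [ae_restrict_mem measurableSet_Ioi] with x hx
  have : (1 + x) ≠ 0 := by have : 0 < x := hx; positivity
  field_simp

theorem integrable_mul_slice (h : IsDiffusiveLSWSolution ε m c₀ c L) {t : ℝ} (ht : 0 ≤ t)
    {g : ℝ → ℝ} {K : ℝ} (hg : AEStronglyMeasurable g (volume.restrict (Ioi 0)))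
    (hK : ∀ x, 0 < x → |g x| ≤ K * (1 + x)) :
    IntegrableOn (fun x => g x * c x t) (Ioi 0) := by
  refine ((h.integrable_slice t ht).const_mul K).mono'
    (hg.mul (h.aestronglyMeasurable_slice ht)) ?_
  filter_upwards [ae_restrict_mem measurableSet_Ioi] with x hx
  rw [Real.norm_eq_abs, abs_mul, abs_of_nonneg (h.nonneg t ht x hx), ← mul_assoc]
  exact mul_le_mul_of_nonneg_right (hK x hx) (h.nonneg t ht x hx)

theorem integrable_strip (h : IsDiffusiveLSWSolution ε m c₀ c L) {s t : ℝ} (hs : 0 ≤ s)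
    (hst : s ≤ t) :
    Integrable (fun p : ℝ × ℝ => (1 + p.1) * c p.1 p.2) (stripMeasure s t) := by
  rw [stripMeasure_eq]
  refine (h.integrable_prod (t + 1) (by linarith)).mono_set ?_
  rintro p ⟨h1, h2⟩
  exact ⟨h1, by have := h2.1; linarith, by have := h2.2; linarith⟩

theorem aestronglyMeasurable_strip (h : IsDiffusiveLSWSolution ε m c₀ c L) {s t : ℝ} (hs : 0 ≤ s)
    (hst : s ≤ t) :
    AEStronglyMeasurable (fun p : ℝ × ℝ => c p.1 p.2) (stripMeasure s t) := by
  have h1 : AEStronglyMeasurable (fun p : ℝ × ℝ => (1 + p.1)⁻¹ * ((1 + p.1) * c p.1 p.2))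
      (stripMeasure s t) :=
    (Measurable.aestronglyMeasurable (by fun_prop)).mul (h.integrable_strip hs hst).1
  refine h1.congr ?_
  filter_upwards [ae_stripMeasure_mem s t] with p hp
  have : (1 + p.1) ≠ 0 := by have := hp.1; positivity
  field_simp

theorem integrable_mul_strip (h : IsDiffusiveLSWSolution ε m c₀ c L) {s t : ℝ} (hs : 0 ≤ s)
    (hst : s ≤ t) {g : ℝ × ℝ → ℝ} {K : ℝ} (hg : AEStronglyMeasurable g (stripMeasure s t))
    (hK : ∀ x τ, 0 < x → τ ∈ Ioc s t → |g (x, τ)| ≤ K * (1 + x)) :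
    Integrable (fun p : ℝ × ℝ => g p * c p.1 p.2) (stripMeasure s t) := by
  refine ((h.integrable_strip hs hst).const_mul K).mono'
    (hg.mul (h.aestronglyMeasurable_strip hs hst)) ?_
  filter_upwards [ae_stripMeasure_mem s t] with p hp
  have hc := h.nonneg p.2 (hs.trans hp.2.1.le) p.1 hp.1
  rw [Real.norm_eq_abs, abs_mul, abs_of_nonneg hc, ← mul_assoc]
  exact mul_le_mul_of_nonneg_right (hK p.1 p.2 hp.1 hp.2) hc

theorem exists_L_lower_bound (h : IsDiffusiveLSWSolution ε m c₀ c L) {s t : ℝ} (hs : 0 ≤ s)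
    (hst : s ≤ t) : ∃ ℓ₀ : ℝ, 0 < ℓ₀ ∧ ∀ τ ∈ Ioc s t, ℓ₀ ≤ L τ := by
  obtain ⟨y, hy, hmin⟩ := isCompact_Icc.exists_isMinOn (nonempty_Icc.2 hst)
    (h.continuousOn_L.mono (fun x (hx : x ∈ Icc s t) => hs.trans hx.1))
  exact ⟨L y, h.L_pos y (hs.trans hy.1), fun τ hτ => hmin ⟨hτ.1.le, hτ.2⟩⟩

theorem aemeasurable_L_strip (h : IsDiffusiveLSWSolution ε m c₀ c L) {s t : ℝ} (hs : 0 ≤ s) :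
    AEMeasurable (fun p : ℝ × ℝ => L p.2) (stripMeasure s t) := by
  have : AEMeasurable L (volume.restrict (Ioc s t)) :=
    (h.continuousOn_L.mono (fun x (hx : x ∈ Ioc s t) => hs.trans hx.1.le)).aemeasurable
      measurableSet_Ioc
  exact this.comp_snd

theorem aestronglyMeasurable_lswGen (h : IsDiffusiveLSWSolution ε m c₀ c L) {s t : ℝ}
    (hs : 0 ≤ s) {g₁ g₂ : ℝ → ℝ}
    (h₁ : AEMeasurable g₁ (volume.restrict (Ioi 0)))
    (h₂ : AEMeasurable g₂ (volume.restrict (Ioi 0))) :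
    AEStronglyMeasurable (fun p : ℝ × ℝ => lswGen ε (L p.2) g₁ g₂ p.1) (stripMeasure s t) := by
  have hL := h.aemeasurable_L_strip (t := t) hs
  have e₁ : AEMeasurable (fun p : ℝ × ℝ => g₁ p.1) (stripMeasure s t) := h₁.comp_fst
  have e₂ : AEMeasurable (fun p : ℝ × ℝ => g₂ p.1) (stripMeasure s t) := h₂.comp_fst
  have e₃ : AEMeasurable (fun p : ℝ × ℝ => p.1) (stripMeasure s t) := measurable_fst.aemeasurable
  unfold lswGen
  refine AEMeasurable.aestronglyMeasurable ?_
  exact ((((e₃.div_const ε).const_add 1).pow_const _).const_mul ε |>.mul e₂).sub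
    ((((e₃.div hL).pow_const _).const_sub 1).mul e₁)

theorem integrable_lswGen_mul_strip (h : IsDiffusiveLSWSolution ε m c₀ c L) (hε : 0 < ε)
    (hε1 : ε ≤ 1) {s t : ℝ} (hs : 0 ≤ s) (hst : s ≤ t) {g₁ g₂ : ℝ → ℝ} {K : ℝ}
    (h₁ : AEMeasurable g₁ (volume.restrict (Ioi 0)))
    (h₂ : AEMeasurable g₂ (volume.restrict (Ioi 0)))
    (b₁ : ∀ x, 0 < x → |g₁ x| ≤ K) (b₂ : ∀ x, 0 < x → |g₂ x| ≤ K) :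
    Integrable (fun p : ℝ × ℝ => lswGen ε (L p.2) g₁ g₂ p.1 * c p.1 p.2) (stripMeasure s t) := by
  obtain ⟨ℓ₀, hℓ₀, hL⟩ := h.exists_L_lower_bound hs hst
  exact h.integrable_mul_strip hs hst (h.aestronglyMeasurable_lswGen hs h₁ h₂)
    (K := (3 + 1 / ℓ₀) * K)
    fun x τ hx hτ => abs_lswGen_le hε hε1 hℓ₀ (hL τ hτ) hx (b₁ x hx) (b₂ x hx)

end IsDiffusiveLSWSolution

/-- For an integrable function on a strip, the iterated integral (space first) is the
integral over the strip. -/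
theorem integral_strip_eq {s t : ℝ} (hst : s ≤ t) {g : ℝ × ℝ → ℝ}
    (hg : Integrable g (stripMeasure s t)) :
    ∫ p, g p ∂(stripMeasure s t) = ∫ τ in s..t, ∫ x in Ioi 0, g (x, τ) := by
  rw [intervalIntegral.integral_of_le hst]
  exact integral_prod_symm g hg

theorem intervalIntegrable_slice_integral {s t : ℝ} (hst : s ≤ t) {g : ℝ × ℝ → ℝ}
    (hg : Integrable g (stripMeasure s t)) :
    IntervalIntegrable (fun τ => ∫ x in Ioi 0, g (x, τ)) volume s t := by
  rw [intervalIntegrable_iff_integrableOn_Ioc_of_le hst]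
  exact hg.integral_prod_right

/-! ### Test functions of unbounded support -/

/-- A function smooth on `(-d, ∞)` agrees on a neighbourhood of `[0, ∞)` with a smooth function on
the whole line: multiply by a smooth step. -/
theorem exists_contDiff_eqOn_Ioi {f : ℝ → ℝ} {d : ℝ} (hd : 0 < d)
    (hf : ContDiffOn ℝ ∞ f (Ioi (-d))) :
    ∃ F : ℝ → ℝ, ContDiff ℝ ∞ F ∧ EqOn F f (Ioi (-(d / 2))) := by
  refine ⟨fun x => Real.smoothTransition (4 * x / d + 3) * f x, ?_, ?_⟩
  · rw [contDiff_iff_contDiffAt]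
    intro x
    by_cases hx : -d < x
    · have h1 : ContDiff ℝ ∞ (fun x : ℝ => Real.smoothTransition (4 * x / d + 3)) :=
        Real.smoothTransition.contDiff.comp
          (((contDiff_const.mul contDiff_id).div_const d).add contDiff_const)
      exact h1.contDiffAt.mul (hf.contDiffAt (Ioi_mem_nhds hx))
    · refine (contDiffAt_const (c := (0 : ℝ))).congr_of_eventuallyEq ?_
      have hx' : x < -(3 * d / 4) := by linarith
      filter_upwards [Iio_mem_nhds hx'] with y hy
      have hy' : y < -(3 * d / 4) := hy
      rw [Real.smoothTransition.zero_of_nonpos, zero_mul]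
      have : 4 * y / d ≤ -3 := by
        rw [div_le_iff₀ hd]; linarith
      linarith
  · intro x hx
    have hx' : -(d / 2) < x := hx
    have : 1 ≤ 4 * x / d + 3 := by
      have : -2 ≤ 4 * x / d := by rw [le_div_iff₀ hd]; linarith
      linarith
    simp only [Real.smoothTransition.one_of_one_le this, one_mul]

/-- A smooth cutoff with the bounds that control the derivatives of `f x * χ (r x)` uniformly in
`r ≤ 1` when `|f x| ≲ x`. -/
theorem exists_cutoff :
    ∃ (χ : ℝ → ℝ) (M : ℝ), ContDiff ℝ ∞ χ ∧ HasCompactSupport χ ∧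
      (∀ x, |x| < 1 → χ x = 1) ∧ ∀ x, |χ x| ≤ M ∧ |deriv χ x| ≤ M ∧ |x * deriv χ x| ≤ M ∧
        |x * deriv (deriv χ) x| ≤ M := by
  let b : ContDiffBump (0 : ℝ) := ⟨1, 2, one_pos, by norm_num⟩
  have hb : ContDiff ℝ ∞ (b : ℝ → ℝ) := b.contDiff
  have hs : HasCompactSupport (b : ℝ → ℝ) := b.hasCompactSupport
  have c1 : ContDiff ℝ ∞ (deriv b) := (contDiff_infty_iff_deriv.1 hb).2
  have c2 : ContDiff ℝ ∞ (deriv (deriv b)) := (contDiff_infty_iff_deriv.1 c1).2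
  obtain ⟨M0, h0⟩ := hb.continuous.bounded_above_of_compact_support hs
  obtain ⟨M1, h1⟩ := c1.continuous.bounded_above_of_compact_support hs.deriv
  obtain ⟨M2, h2⟩ := (continuous_id.mul c1.continuous).bounded_above_of_compact_support
    (hs.deriv.mul_left)
  obtain ⟨M3, h3⟩ := (continuous_id.mul c2.continuous).bounded_above_of_compact_support
    (hs.deriv.deriv.mul_left)
  refine ⟨b, max (max M0 M1) (max M2 M3), hb, hs, ?_, fun x => ⟨?_, ?_, ?_, ?_⟩⟩
  · intro x hx
    exact b.one_of_mem_closedBall (by simpa [b] using hx.le)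
  · exact (h0 x).trans (by simp)
  · exact (h1 x).trans (by simp)
  · exact (h2 x).trans (by simp)
  · exact (h3 x).trans (by simp)

/-- A test function with possibly unbounded support: `f` is smooth on a neighbourhood
`(-d, ∞)` of `[0, ∞)`, vanishes at `0`, and its first two derivatives, `f₁` and `f₂` on
`(0, ∞)`, are bounded there by `K`. -/
structure IsLipschitzTest (f f₁ f₂ : ℝ → ℝ) (d K : ℝ) : Prop where
  d_pos : 0 < d
  smooth : ContDiffOn ℝ ∞ f (Ioi (-d))
  zero : f 0 = 0
  hasDeriv₁ : ∀ x, 0 < x → HasDerivAt f (f₁ x) x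
  hasDeriv₂ : ∀ x, 0 < x → HasDerivAt f₁ (f₂ x) x
  bound₁ : ∀ x, 0 < x → |f₁ x| ≤ K
  bound₂ : ∀ x, 0 < x → |f₂ x| ≤ K

namespace IsLipschitzTest

variable {f f₁ f₂ : ℝ → ℝ} {d K : ℝ}

theorem K_nonneg (h : IsLipschitzTest f f₁ f₂ d K) : 0 ≤ K :=
  (abs_nonneg _).trans (h.bound₁ 1 one_pos)

theorem aemeasurable (h : IsLipschitzTest f f₁ f₂ d K) :
    AEMeasurable f (volume.restrict (Ioi 0)) :=
  (h.smooth.continuousOn.mono (Ioi_subset_Ioi (by linarith [h.d_pos]))).aemeasurable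
    measurableSet_Ioi

theorem aemeasurable₁ (h : IsLipschitzTest f f₁ f₂ d K) :
    AEMeasurable f₁ (volume.restrict (Ioi 0)) :=
  ContinuousOn.aemeasurable (fun x hx => (h.hasDeriv₂ x hx).continuousAt.continuousWithinAt)
    measurableSet_Ioi

theorem aemeasurable₂ (h : IsLipschitzTest f f₁ f₂ d K) :
    AEMeasurable f₂ (volume.restrict (Ioi 0)) := by
  refine (measurable_deriv f₁).aemeasurable.congr ?_
  filter_upwards [ae_restrict_mem measurableSet_Ioi] with x hx
  exact (h.hasDeriv₂ x hx).deriv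

theorem abs_le (h : IsLipschitzTest f f₁ f₂ d K) {x : ℝ} (hx : 0 < x) : |f x| ≤ K * x := by
  have hc : ContinuousOn f (Icc 0 x) :=
    h.smooth.continuousOn.mono fun y hy => by
      have := h.d_pos; have := hy.1; simp only [mem_Ioi]; linarith
  obtain ⟨y, hy, e⟩ := exists_hasDerivAt_eq_slope f f₁ hx hc (fun y hy => h.hasDeriv₁ y hy.1)
  rw [h.zero, sub_zero, sub_zero, eq_div_iff hx.ne'] at e
  rw [← e, abs_mul, abs_of_pos hx]
  exact mul_le_mul_of_nonneg_right (h.bound₁ y hy.1) hx.le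

end IsLipschitzTest

namespace IsDiffusiveLSWSolution

variable {ε m : ℝ} {c₀ : ℝ → ℝ} {c : ℝ → ℝ → ℝ} {L : ℝ → ℝ}

/-- The weak equation extends to smooth test functions of unbounded support with two bounded
derivatives: cut them off at `x ∼ n` and use dominated convergence, since
`(1 + x) c` is integrable. -/
theorem weak_eq_of_lipschitz (h : IsDiffusiveLSWSolution ε m c₀ c L) (hε : 0 < ε) (hε1 : ε ≤ 1)
    {f f₁ f₂ : ℝ → ℝ} {d K : ℝ} (hf : IsLipschitzTest f f₁ f₂ d K) {t : ℝ} (ht : 0 ≤ t) :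
    (∫ x in Ioi 0, f x * c x t) - (∫ x in Ioi 0, f x * c x 0)
      = ∫ s in (0 : ℝ)..t, ∫ x in Ioi 0, lswGen ε (L s) f₁ f₂ x * c x s := by
  obtain ⟨F, hF, hFf⟩ := exists_contDiff_eqOn_Ioi hf.d_pos hf.smooth
  obtain ⟨χ, M, hχ, hχs, hχ1, hχb⟩ := exists_cutoff
  have hM : 0 ≤ M := (abs_nonneg _).trans (hχb 0).1
  have hK := hf.K_nonneg
  have hFf' : ∀ x, 0 ≤ x → F x = f x := fun x hx => hFf (by
    have := hf.d_pos; simp only [mem_Ioi]; linarith)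
  let r : ℕ → ℝ := fun n => ((n : ℝ) + 1)⁻¹
  have hr : ∀ n, 0 < r n := fun n => by positivity
  have hr1 : ∀ n, r n ≤ 1 := fun n => inv_le_one_of_one_le₀ (by
    have : (0 : ℝ) ≤ n := n.cast_nonneg
    linarith)
  have hr0 : Filter.Tendsto r Filter.atTop (nhds 0) := by
    simpa [r, one_div] using tendsto_one_div_add_atTop_nhds_zero_nat (𝕜 := ℝ)
  let φ : ℕ → ℝ → ℝ := fun n x => F x * χ (r n * x)
  let φ₁ : ℕ → ℝ → ℝ := fun n x => f₁ x * χ (r n * x) + f x * (deriv χ (r n * x) * r n)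
  let φ₂ : ℕ → ℝ → ℝ := fun n x => (f₂ x * χ (r n * x) + f₁ x * (deriv χ (r n * x) * r n))
    + (f₁ x * (deriv χ (r n * x) * r n)
      + f x * (deriv (deriv χ) (r n * x) * r n * r n))
  have dχ : ∀ n x, HasDerivAt (fun x => χ (r n * x)) (deriv χ (r n * x) * r n) x := by
    intro n x
    have h1 := ((hχ.differentiable (by norm_num)) (r n * x)).hasDerivAt
    have h2 : HasDerivAt (fun x => r n * x) (r n) x := by
      simpa using (hasDerivAt_id x).const_mul (r n)
    exact h1.comp x h2
  have dχ' : ∀ n x, HasDerivAt (fun x => deriv χ (r n * x) * r n)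
      (deriv (deriv χ) (r n * x) * r n * r n) x := by
    intro n x
    have h1 := (((contDiff_infty_iff_deriv.1 hχ).2.differentiable (by norm_num))
      (r n * x)).hasDerivAt
    have h2 : HasDerivAt (fun x => r n * x) (r n) x := by
      simpa using (hasDerivAt_id x).const_mul (r n)
    exact (h1.comp x h2).mul_const (r n)
  have hnhds : ∀ x : ℝ, 0 < x → ∀ᶠ y in nhds x, 0 < y := fun x hx => Ioi_mem_nhds hx
  have dφ : ∀ n x, 0 < x → deriv (φ n) x = φ₁ n x := by
    intro n x hx
    have : HasDerivAt (fun x => f x * χ (r n * x)) (φ₁ n x) x :=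
      (hf.hasDeriv₁ x hx).mul (dχ n x)
    refine (this.congr_of_eventuallyEq ?_).deriv
    filter_upwards [hnhds x hx] with y hy
    simp only [φ, hFf' y hy.le]
  have ddφ : ∀ n x, 0 < x → deriv (deriv (φ n)) x = φ₂ n x := by
    intro n x hx
    have : HasDerivAt (φ₁ n) (φ₂ n x) x :=
      ((hf.hasDeriv₂ x hx).mul (dχ n x)).add ((hf.hasDeriv₁ x hx).mul (dχ' n x))
    refine (this.congr_of_eventuallyEq ?_).deriv
    filter_upwards [hnhds x hx] with y hy
    exact dφ n y hy
  have bfχ' : ∀ n x, 0 < x → |f x * (deriv χ (r n * x) * r n)| ≤ K * M := by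
    intro n x hx
    have h1 := (hχb (r n * x)).2.2.1
    calc |f x * (deriv χ (r n * x) * r n)| = |f x| * |deriv χ (r n * x)| * r n := by
          rw [abs_mul, abs_mul, abs_of_pos (hr n), mul_assoc]
      _ ≤ K * x * |deriv χ (r n * x)| * r n := by
          have := (hr n).le
          gcongr
          exact hf.abs_le hx
      _ = K * |r n * x * deriv χ (r n * x)| := by
          rw [abs_mul, abs_of_pos (mul_pos (hr n) hx)]; ring
      _ ≤ K * M := by gcongr
  have bfχ'' : ∀ n x, 0 < x → |f x * (deriv (deriv χ) (r n * x) * r n * r n)| ≤ K * M := by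
    intro n x hx
    have h1 := (hχb (r n * x)).2.2.2
    calc |f x * (deriv (deriv χ) (r n * x) * r n * r n)|
          = |f x| * |deriv (deriv χ) (r n * x)| * r n * r n := by
          rw [abs_mul, abs_mul, abs_mul, abs_of_pos (hr n)]; ring
      _ ≤ K * x * |deriv (deriv χ) (r n * x)| * r n * 1 := by
          have := (hr n).le
          gcongr
          · exact hf.abs_le hx
          · exact hr1 n
      _ = K * |r n * x * deriv (deriv χ) (r n * x)| := by
          rw [abs_mul, abs_of_pos (mul_pos (hr n) hx)]; ring
      _ ≤ K * M := by gcongr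
  have bf₁χ : ∀ n x, 0 < x → |f₁ x * χ (r n * x)| ≤ K * M := fun n x hx => by
    rw [abs_mul]; exact mul_le_mul (hf.bound₁ x hx) (hχb _).1 (abs_nonneg _) hK
  have bf₂χ : ∀ n x, 0 < x → |f₂ x * χ (r n * x)| ≤ K * M := fun n x hx => by
    rw [abs_mul]; exact mul_le_mul (hf.bound₂ x hx) (hχb _).1 (abs_nonneg _) hK
  have bf₁χ' : ∀ n x, 0 < x → |f₁ x * (deriv χ (r n * x) * r n)| ≤ K * M := fun n x hx => by
    rw [abs_mul, abs_mul, abs_of_pos (hr n)]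
    refine mul_le_mul (hf.bound₁ x hx) ?_ (mul_nonneg (abs_nonneg _) (hr n).le) hK
    calc |deriv χ (r n * x)| * r n ≤ M * 1 :=
          mul_le_mul (hχb _).2.1 (hr1 n) (hr n).le hM
      _ = M := mul_one M
  have hKM : 0 ≤ K * M := mul_nonneg hK hM
  have bφ : ∀ n x, 0 < x → |φ n x| ≤ K * M * (1 + x) := by
    intro n x hx
    simp only [φ, hFf' x hx.le, abs_mul]
    calc |f x| * |χ (r n * x)| ≤ K * x * M :=
          mul_le_mul (hf.abs_le hx) (hχb _).1 (abs_nonneg _) (by positivity)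
      _ ≤ K * M * (1 + x) := by nlinarith
  have bφ₁ : ∀ n x, 0 < x → |φ₁ n x| ≤ 4 * (K * M) := by
    intro n x hx
    have := abs_add_le (f₁ x * χ (r n * x)) (f x * (deriv χ (r n * x) * r n))
    have := bf₁χ n x hx; have := bfχ' n x hx
    simp only [φ₁]; linarith
  have bφ₂ : ∀ n x, 0 < x → |φ₂ n x| ≤ 4 * (K * M) := by
    intro n x hx
    have h1 := abs_add_le (f₂ x * χ (r n * x)) (f₁ x * (deriv χ (r n * x) * r n))
    have h2 := abs_add_le (f₁ x * (deriv χ (r n * x) * r n))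
      (f x * (deriv (deriv χ) (r n * x) * r n * r n))
    have h3 := abs_add_le (f₂ x * χ (r n * x) + f₁ x * (deriv χ (r n * x) * r n))
      (f₁ x * (deriv χ (r n * x) * r n)
      + f x * (deriv (deriv χ) (r n * x) * r n * r n))
    have := bf₂χ n x hx; have := bf₁χ' n x hx; have := bfχ'' n x hx
    simp only [φ₂]; linarith
  -- near a fixed point the cutoff is eventually identically one
  have hev : ∀ x : ℝ, ∀ᶠ n in Filter.atTop,
      χ (r n * x) = 1 ∧ deriv χ (r n * x) = 0 ∧ deriv (deriv χ) (r n * x) = 0 := by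
    intro x
    have h0 : Filter.Tendsto (fun n => r n * x) Filter.atTop (nhds 0) := by
      simpa using hr0.mul_const x
    have hb : Metric.ball (0 : ℝ) 1 ∈ nhds (0 : ℝ) := Metric.ball_mem_nhds 0 one_pos
    have d0 : ∀ y ∈ Metric.ball (0 : ℝ) 1, deriv χ y = 0 := by
      intro y hy
      have : χ =ᶠ[nhds y] fun _ => 1 := by
        filter_upwards [Metric.isOpen_ball.mem_nhds hy] with z hz
        exact hχ1 z (by simpa using hz)
      rw [this.deriv_eq, deriv_const]
    have d1 : ∀ y ∈ Metric.ball (0 : ℝ) 1, deriv (deriv χ) y = 0 := by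
      intro y hy
      have : deriv χ =ᶠ[nhds y] fun _ => 0 := by
        filter_upwards [Metric.isOpen_ball.mem_nhds hy] with z hz
        exact d0 z hz
      rw [this.deriv_eq, deriv_const]
    filter_upwards [h0.eventually hb] with n hn
    exact ⟨hχ1 _ (by simpa using hn), d0 _ hn, d1 _ hn⟩
  have hφsm : ∀ n, ContDiff ℝ ∞ (φ n) := fun n =>
    hF.mul (hχ.comp (contDiff_const.mul contDiff_id))
  have hφs : ∀ n, HasCompactSupport (φ n) := fun n => by
    have : HasCompactSupport (fun x => χ (r n * x)) := by
      have := hχs.comp_homeomorph (Homeomorph.mulLeft₀ (r n) (hr n).ne')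
      exact this
    exact this.mul_left
  have hφ0 : ∀ n, φ n 0 = 0 := fun n => by simp [φ, hFf' 0 le_rfl, hf.zero]
  have hslice : ∀ τ, 0 ≤ τ → Filter.Tendsto (fun n => ∫ x in Ioi 0, φ n x * c x τ) Filter.atTop
      (nhds (∫ x in Ioi 0, f x * c x τ)) := by
    intro τ hτ
    refine tendsto_integral_of_dominated_convergence (fun x => K * M * ((1 + x) * c x τ))
      (fun n => (hφsm n).continuous.aestronglyMeasurable.mul (h.aestronglyMeasurable_slice hτ))
      ((h.integrable_slice τ hτ).const_mul _) (fun n => ?_) ?_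
    · filter_upwards [ae_restrict_mem measurableSet_Ioi] with x hx
      rw [Real.norm_eq_abs, abs_mul, abs_of_nonneg (h.nonneg τ hτ x hx), ← mul_assoc]
      exact mul_le_mul_of_nonneg_right (bφ n x hx) (h.nonneg τ hτ x hx)
    · filter_upwards [ae_restrict_mem measurableSet_Ioi] with x hx
      refine tendsto_const_nhds.congr' ?_
      filter_upwards [hev x] with n hn
      simp only [φ, hn.1, mul_one, hFf' x (le_of_lt hx)]
  obtain ⟨ℓ₀, hℓ₀, hL⟩ := h.exists_L_lower_bound le_rfl ht
  have hstrip : Filter.Tendsto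
      (fun n => ∫ p, lswGen ε (L p.2) (deriv (φ n)) (deriv (deriv (φ n))) p.1 * c p.1 p.2
        ∂(stripMeasure 0 t)) Filter.atTop
      (nhds (∫ p, lswGen ε (L p.2) f₁ f₂ p.1 * c p.1 p.2 ∂(stripMeasure 0 t))) := by
    refine tendsto_integral_of_dominated_convergence
      (fun p => (3 + 1 / ℓ₀) * (4 * (K * M)) * ((1 + p.1) * c p.1 p.2))
      (fun n => (h.aestronglyMeasurable_lswGen le_rfl (measurable_deriv _).aemeasurable
        (measurable_deriv _).aemeasurable).mul (h.aestronglyMeasurable_strip le_rfl ht))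
      ((h.integrable_strip le_rfl ht).const_mul _) (fun n => ?_) ?_
    · filter_upwards [ae_stripMeasure_mem 0 t] with p hp
      have hc := h.nonneg p.2 hp.2.1.le p.1 hp.1
      rw [Real.norm_eq_abs, abs_mul, abs_of_nonneg hc, ← mul_assoc]
      refine mul_le_mul_of_nonneg_right ?_ hc
      refine abs_lswGen_le hε hε1 hℓ₀ (hL _ hp.2) hp.1 ?_ ?_
      · rw [dφ n _ hp.1]; exact bφ₁ n _ hp.1
      · rw [ddφ n _ hp.1]; exact bφ₂ n _ hp.1
    · filter_upwards [ae_stripMeasure_mem 0 t] with p hp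
      refine tendsto_const_nhds.congr' ?_
      filter_upwards [hev p.1] with n hn
      have e1 : deriv (φ n) p.1 = f₁ p.1 := by
        rw [dφ n _ hp.1]; simp only [φ₁, hn.1, hn.2.1]; ring
      have e2 : deriv (deriv (φ n)) p.1 = f₂ p.1 := by
        rw [ddφ n _ hp.1]; simp only [φ₂, hn.1, hn.2.1, hn.2.2]; ring
      simp only [lswGen, e1, e2]
  have hc₀ : ∀ g : ℝ → ℝ, ∫ x in Ioi 0, g x * c₀ x = ∫ x in Ioi 0, g x * c x 0 := by
    intro g
    refine setIntegral_congr_fun measurableSet_Ioi fun x hx => ?_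
    simp only [h.initial x hx]
  have hweak : ∀ n, (∫ x in Ioi 0, φ n x * c x t) - (∫ x in Ioi 0, φ n x * c x 0)
      = ∫ p, lswGen ε (L p.2) (deriv (φ n)) (deriv (deriv (φ n))) p.1 * c p.1 p.2
        ∂(stripMeasure 0 t) := by
    intro n
    have hw := h.weak_eq (φ n) (hφsm n) (hφs n) (hφ0 n) t ht
    rw [hc₀] at hw
    rw [hw, integral_strip_eq ht]
    · rfl
    · refine h.integrable_lswGen_mul_strip hε hε1 le_rfl ht (measurable_deriv _).aemeasurable
        (measurable_deriv _).aemeasurable (K := 4 * (K * M)) ?_ ?_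
      · intro x hx; rw [dφ n _ hx]; exact bφ₁ n _ hx
      · intro x hx; rw [ddφ n _ hx]; exact bφ₂ n _ hx
  rw [← integral_strip_eq ht (g := fun p => lswGen ε (L p.2) f₁ f₂ p.1 * c p.1 p.2)
    (h.integrable_lswGen_mul_strip hε hε1 le_rfl ht hf.aemeasurable₁ hf.aemeasurable₂
      hf.bound₁ hf.bound₂)]
  refine tendsto_nhds_unique ((hslice t ht).sub (hslice 0 le_rfl)) ?_
  simpa only [hweak] using hstrip

theorem weak_eq_strip (h : IsDiffusiveLSWSolution ε m c₀ c L) (hε : 0 < ε) (hε1 : ε ≤ 1)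
    {f f₁ f₂ : ℝ → ℝ} {d K : ℝ} (hf : IsLipschitzTest f f₁ f₂ d K) {s t : ℝ} (hs : 0 ≤ s)
    (hst : s ≤ t) :
    (∫ x in Ioi 0, f x * c x t) - (∫ x in Ioi 0, f x * c x s)
      = ∫ p, lswGen ε (L p.2) f₁ f₂ p.1 * c p.1 p.2 ∂(stripMeasure s t) := by
  have ht := hs.trans hst
  have I : ∀ {a b : ℝ}, 0 ≤ a → a ≤ b → Integrable
      (fun p : ℝ × ℝ => lswGen ε (L p.2) f₁ f₂ p.1 * c p.1 p.2) (stripMeasure a b) :=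
    fun ha hab => h.integrable_lswGen_mul_strip hε hε1 ha hab hf.aemeasurable₁ hf.aemeasurable₂
      hf.bound₁ hf.bound₂
  have h1 := h.weak_eq_of_lipschitz hε hε1 hf ht
  have h2 := h.weak_eq_of_lipschitz hε hε1 hf hs
  have h3 := intervalIntegral.integral_add_adjacent_intervals
    (intervalIntegrable_slice_integral hs (I le_rfl hs))
    (intervalIntegrable_slice_integral hst (I hs hst))
  rw [integral_strip_eq hst (I hs hst)]
  dsimp only at h3 ⊢
  linarith

end IsDiffusiveLSWSolution

/-! ### Dissipation of the energy -/

/-- The density, per cluster of volume `x`, of the rate of decrease of the regularised energy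
`∫ ((x + δ)^{2/3} - δ^{2/3}) c dx`, after mass conservation has been used to symmetrise the
drift term. For `δ = 0` the drift part is `(2/3) (1 - u/v)² / u`, where `u = x^{1/3}`
and `v = ℓ^{1/3}`. -/
noncomputable def dissipation (δ ε ℓ x : ℝ) : ℝ :=
  2 / 9 * (ε * (1 + x / ε) ^ (1 / 3 : ℝ)) * (x + δ) ^ (-(4 / 3) : ℝ)
    + 2 / 3 * ((1 - (x / ℓ) ^ (1 / 3 : ℝ)) * ((x + δ) ^ (-(1 / 3) : ℝ) - (ℓ + δ) ^ (-(1 / 3) : ℝ)))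

theorem dissipation_nonneg {δ ε ℓ x : ℝ} (hδ : 0 ≤ δ) (hε : 0 < ε) (hℓ : 0 < ℓ) (hx : 0 < x) :
    0 ≤ dissipation δ ε ℓ x := by
  have h1 : 0 ≤ (1 - (x / ℓ) ^ (1 / 3 : ℝ))
      * ((x + δ) ^ (-(1 / 3) : ℝ) - (ℓ + δ) ^ (-(1 / 3) : ℝ)) := by
    rcases le_total x ℓ with h | h
    · refine mul_nonneg ?_ ?_
      · exact sub_nonneg.2 (Real.rpow_le_one (by positivity) ((div_le_one hℓ).2 h) (by norm_num))
      · exact sub_nonneg.2 (Real.rpow_le_rpow_of_nonpos (by linarith) (by linarith) (by norm_num))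
    · refine mul_nonneg_of_nonpos_of_nonpos ?_ ?_
      · exact sub_nonpos.2 (Real.one_le_rpow ((one_le_div hℓ).2 h) (by norm_num))
      · exact sub_nonpos.2 (Real.rpow_le_rpow_of_nonpos (by linarith) (by linarith) (by norm_num))
  have := diffusion_nonneg hε hx
  have : 0 < x + δ := by linarith
  unfold dissipation
  positivity

theorem isLipschitzTest_id : IsLipschitzTest (fun x => x) (fun _ => 1) (fun _ => 0) 1 1 where
  d_pos := one_pos
  smooth := contDiff_id.contDiffOn
  zero := rfl
  hasDeriv₁ x _ := hasDerivAt_id x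
  hasDeriv₂ x _ := hasDerivAt_const x 1
  bound₁ x _ := by simp
  bound₂ x _ := by simp

theorem isLipschitzTest_energy {δ : ℝ} (hδ : 0 < δ) :
    IsLipschitzTest (fun x => (x + δ) ^ (2 / 3 : ℝ) - δ ^ (2 / 3 : ℝ))
      (fun x => 2 / 3 * (x + δ) ^ (-(1 / 3) : ℝ)) (fun x => -(2 / 9 * (x + δ) ^ (-(4 / 3) : ℝ)))
      δ (δ ^ (-(1 / 3) : ℝ) + δ ^ (-(4 / 3) : ℝ)) where
  d_pos := hδ
  smooth := by
    refine ContDiffOn.sub ?_ contDiffOn_const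
    intro x hx
    have hx' : -δ < x := hx
    exact ((contDiffAt_id.add contDiffAt_const).rpow_const_of_ne
      (by simp only [id]; linarith)).contDiffWithinAt
  zero := by simp
  hasDeriv₁ x hx := by
    have h1 : HasDerivAt (fun x => x + δ) 1 x := (hasDerivAt_id x).add_const δ
    have h2 := (h1.rpow_const (p := (2 / 3 : ℝ)) (Or.inl (by linarith))).sub_const (δ ^ (2 / 3 : ℝ))
    refine h2.congr_deriv ?_
    norm_num
  hasDeriv₂ x hx := by
    have h1 : HasDerivAt (fun x => x + δ) 1 x := (hasDerivAt_id x).add_const δ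
    have h2 := (h1.rpow_const (p := (-(1 / 3) : ℝ)) (Or.inl (by linarith))).const_mul (2 / 3 : ℝ)
    refine h2.congr_deriv ?_
    norm_num
    ring
  bound₁ x hx := by
    have h1 : (x + δ) ^ (-(1 / 3) : ℝ) ≤ δ ^ (-(1 / 3) : ℝ) :=
      Real.rpow_le_rpow_of_nonpos hδ (by linarith) (by norm_num)
    have h2 : 0 < (x + δ) ^ (-(1 / 3) : ℝ) := by positivity
    have h3 : 0 < δ ^ (-(4 / 3) : ℝ) := by positivity
    rw [abs_of_pos (by positivity)]
    linarith
  bound₂ x hx := by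
    have h1 : (x + δ) ^ (-(4 / 3) : ℝ) ≤ δ ^ (-(4 / 3) : ℝ) :=
      Real.rpow_le_rpow_of_nonpos hδ (by linarith) (by norm_num)
    have h2 : 0 < (x + δ) ^ (-(4 / 3) : ℝ) := by positivity
    have h3 : 0 < δ ^ (-(1 / 3) : ℝ) := by positivity
    rw [abs_neg, abs_of_pos (by positivity)]
    linarith

theorem rpow_add_sub_mem {δ x : ℝ} (hδ : 0 ≤ δ) (hx : 0 < x) :
    0 ≤ (x + δ) ^ (2 / 3 : ℝ) - δ ^ (2 / 3 : ℝ) ∧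
      (x + δ) ^ (2 / 3 : ℝ) - δ ^ (2 / 3 : ℝ) ≤ x ^ (2 / 3 : ℝ) := by
  constructor
  · exact sub_nonneg.2 (Real.rpow_le_rpow hδ (by linarith) (by norm_num))
  · have := Real.rpow_add_le_add_rpow hx.le hδ (p := (2 / 3 : ℝ)) (by norm_num) (by norm_num)
    linarith

theorem rpow_two_thirds_le {y : ℝ} (hy : 0 ≤ y) : y ^ (2 / 3 : ℝ) ≤ 1 + y := by
  calc y ^ (2 / 3 : ℝ) ≤ (1 + y) ^ (2 / 3 : ℝ) := by gcongr; linarith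
    _ ≤ (1 + y) ^ (1 : ℝ) := Real.rpow_le_rpow_of_exponent_le (by linarith) (by norm_num)
    _ = 1 + y := Real.rpow_one _

namespace IsDiffusiveLSWSolution

variable {ε m : ℝ} {c₀ : ℝ → ℝ} {c : ℝ → ℝ → ℝ} {L : ℝ → ℝ}

/-- Conservation of mass determines `L`: the drift has mean zero at almost every time. -/
theorem ae_integral_drift_eq_zero (h : IsDiffusiveLSWSolution ε m c₀ c L) (hε : 0 < ε)
    (hε1 : ε ≤ 1) {s t : ℝ} (hs : 0 ≤ s) (hst : s ≤ t) :
    ∀ᵐ τ ∂(volume.restrict (Ioc s t)),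
      ∫ x in Ioi 0, (1 - (x / L τ) ^ (1 / 3 : ℝ)) * c x τ = 0 := by
  have hf := isLipschitzTest_id
  have I := h.integrable_lswGen_mul_strip hε hε1 hs hst hf.aemeasurable₁ hf.aemeasurable₂
      hf.bound₁ hf.bound₂
  have hd := (intervalIntegrable_slice_integral hst I).ae_hasDerivAt_integral
  have hz : ∀ y ∈ Icc s t, ∫ τ in s..y, ∫ x in Ioi 0,
      lswGen ε (L τ) (fun _ => 1) (fun _ => 0) x * c x τ = 0 := by
    intro y hy
    have h1 := h.weak_eq_strip hε hε1 hf hs hy.1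
    rw [h.mass y (hs.trans hy.1), h.mass s hs, sub_self, integral_strip_eq hy.1] at h1
    · exact h1.symm
    · exact h.integrable_lswGen_mul_strip hε hε1 hs hy.1 hf.aemeasurable₁ hf.aemeasurable₂
        hf.bound₁ hf.bound₂
  have hne : ∀ᵐ y : ℝ, y ≠ t := by simp [ae_iff, measure_singleton]
  rw [ae_restrict_iff' measurableSet_Ioc]
  filter_upwards [hd, hne] with y hy hyt hys
  have h1 := hy (by rw [uIcc_of_le hst]; exact ⟨hys.1.le, hys.2⟩) s left_mem_uIcc
  have h2 : HasDerivAt (fun _ : ℝ => (0 : ℝ)) 0 y := hasDerivAt_const y 0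
  have h3 := h1.unique (h2.congr_of_eventuallyEq (by
    filter_upwards [Ioo_mem_nhds hys.1 (lt_of_le_of_ne hys.2 hyt)] with z hz'
    exact hz z ⟨hz'.1.le, hz'.2.le⟩))
  have h4 : ∫ x in Ioi 0, (1 - (x / L y) ^ (1 / 3 : ℝ)) * c x y
      = -∫ x in Ioi 0, lswGen ε (L y) (fun _ => 1) (fun _ => 0) x * c x y := by
    rw [← integral_neg]
    congr 1
    ext x
    simp only [lswGen]
    ring
  rw [h4, h3, neg_zero]

/-- The energy identity for the regularised energy: the weak equation, to which a multiple
`k` of the mean-zero drift, depending on time only, is added to make the integrand non-negative. -/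
theorem dissipation_identity (h : IsDiffusiveLSWSolution ε m c₀ c L) (hε : 0 < ε)
    (hε1 : ε ≤ 1) {s t δ : ℝ} (hs : 0 ≤ s) (hst : s ≤ t) (hδ : 0 < δ) :
    Integrable (fun p : ℝ × ℝ => dissipation δ ε (L p.2) p.1 * c p.1 p.2) (stripMeasure s t) ∧
    ∫ p, dissipation δ ε (L p.2) p.1 * c p.1 p.2 ∂(stripMeasure s t)
      = (∫ x in Ioi 0, ((x + δ) ^ (2 / 3 : ℝ) - δ ^ (2 / 3 : ℝ)) * c x s)
        - ∫ x in Ioi 0, ((x + δ) ^ (2 / 3 : ℝ) - δ ^ (2 / 3 : ℝ)) * c x t := by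
  have hf := isLipschitzTest_energy hδ
  have hi := isLipschitzTest_id
  have I₁ := h.integrable_lswGen_mul_strip hε hε1 hs hst hf.aemeasurable₁ hf.aemeasurable₂
      hf.bound₁ hf.bound₂
  obtain ⟨ℓ₀, hℓ₀, hL⟩ := h.exists_L_lower_bound hs hst
  let k : ℝ × ℝ → ℝ := fun p => 2 / 3 * (L p.2 + δ) ^ (-(1 / 3) : ℝ)
  have hk : AEStronglyMeasurable k (stripMeasure s t) :=
    ((((h.aemeasurable_L_strip hs).add_const δ).pow_const _).const_mul _).aestronglyMeasurable
  have I₂ : Integrable (fun p : ℝ × ℝ =>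
      (k p * lswGen ε (L p.2) (fun _ => 1) (fun _ => 0) p.1) * c p.1 p.2) (stripMeasure s t) := by
    refine h.integrable_mul_strip hs hst
      (hk.mul (h.aestronglyMeasurable_lswGen hs hi.aemeasurable₁ hi.aemeasurable₂))
      (K := (δ ^ (-(1 / 3) : ℝ)) * ((3 + 1 / ℓ₀) * 1)) ?_
    intro x τ hx hτ
    have hLτ := hL τ hτ
    have h1 : (L τ + δ) ^ (-(1 / 3) : ℝ) ≤ δ ^ (-(1 / 3) : ℝ) :=
      Real.rpow_le_rpow_of_nonpos hδ (by linarith) (by norm_num)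
    have h0 : 0 < (L τ + δ) ^ (-(1 / 3) : ℝ) := by
      have : 0 < L τ + δ := by linarith
      positivity
    rw [abs_mul, mul_assoc]
    refine mul_le_mul ?_ (abs_lswGen_le hε hε1 hℓ₀ hLτ hx (by simp) (by simp)) (abs_nonneg _)
      (by positivity)
    simp only [k]
    rw [abs_of_pos (by positivity)]
    linarith
  have z : ∫ p, (k p * lswGen ε (L p.2) (fun _ => 1) (fun _ => 0) p.1) * c p.1 p.2
      ∂(stripMeasure s t) = 0 := by
    rw [integral_strip_eq hst I₂, intervalIntegral.integral_of_le hst]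
    refine integral_eq_zero_of_ae ?_
    filter_upwards [h.ae_integral_drift_eq_zero hε hε1 hs hst] with τ hτ
    have : ∀ x, (k (x, τ) * lswGen ε (L τ) (fun _ => 1) (fun _ => 0) x) * c x τ
        = -(2 / 3 * (L τ + δ) ^ (-(1 / 3) : ℝ)) * ((1 - (x / L τ) ^ (1 / 3 : ℝ)) * c x τ) := by
      intro x; simp only [k, lswGen]; ring
    simp only [this, integral_const_mul, hτ, mul_zero, Pi.zero_apply]
  have e : (fun p : ℝ × ℝ => dissipation δ ε (L p.2) p.1 * c p.1 p.2)
      = fun p => (k p * lswGen ε (L p.2) (fun _ => 1) (fun _ => 0) p.1) * c p.1 p.2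
        - lswGen ε (L p.2) (fun x => 2 / 3 * (x + δ) ^ (-(1 / 3) : ℝ))
          (fun x => -(2 / 9 * (x + δ) ^ (-(4 / 3) : ℝ))) p.1 * c p.1 p.2 := by
    ext p
    simp only [dissipation, k, lswGen]
    ring
  rw [e]
  refine ⟨I₂.sub I₁, ?_⟩
  rw [integral_sub I₂ I₁, z, ← h.weak_eq_strip hε hε1 hf hs hst]
  ring

theorem integrable_energy (h : IsDiffusiveLSWSolution ε m c₀ c L) {t : ℝ} (ht : 0 ≤ t) :
    IntegrableOn (fun x => x ^ (2 / 3 : ℝ) * c x t) (Ioi 0) := by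
  refine h.integrable_mul_slice ht (K := 1) (Measurable.aestronglyMeasurable (by fun_prop)) ?_
  intro x hx
  rw [abs_of_nonneg (by positivity), one_mul]
  exact rpow_two_thirds_le hx.le

theorem integrable_energy_reg (h : IsDiffusiveLSWSolution ε m c₀ c L) {t δ : ℝ} (ht : 0 ≤ t)
    (hδ : 0 ≤ δ) :
    IntegrableOn (fun x => ((x + δ) ^ (2 / 3 : ℝ) - δ ^ (2 / 3 : ℝ)) * c x t) (Ioi 0) := by
  refine h.integrable_mul_slice ht (K := 1) (Measurable.aestronglyMeasurable (by fun_prop)) ?_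
  intro x hx
  have := rpow_add_sub_mem hδ hx
  rw [abs_of_nonneg this.1, one_mul]
  exact this.2.trans (rpow_two_thirds_le hx.le)

theorem energy_reg_nonneg (h : IsDiffusiveLSWSolution ε m c₀ c L) {t δ : ℝ} (ht : 0 ≤ t)
    (hδ : 0 ≤ δ) :
    0 ≤ ∫ x in Ioi 0, ((x + δ) ^ (2 / 3 : ℝ) - δ ^ (2 / 3 : ℝ)) * c x t :=
  setIntegral_nonneg measurableSet_Ioi fun x hx =>
    mul_nonneg (rpow_add_sub_mem hδ hx).1 (h.nonneg t ht x hx)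

theorem energy_reg_le (h : IsDiffusiveLSWSolution ε m c₀ c L) {t δ : ℝ} (ht : 0 ≤ t)
    (hδ : 0 ≤ δ) :
    ∫ x in Ioi 0, ((x + δ) ^ (2 / 3 : ℝ) - δ ^ (2 / 3 : ℝ)) * c x t ≤ lswEnergy c t :=
  setIntegral_mono_on (h.integrable_energy_reg ht hδ) (h.integrable_energy ht) measurableSet_Ioi
    fun x hx => mul_le_mul_of_nonneg_right (rpow_add_sub_mem hδ hx).2 (h.nonneg t ht x hx)

theorem tendsto_energy_reg (h : IsDiffusiveLSWSolution ε m c₀ c L) {t : ℝ} (ht : 0 ≤ t)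
    {r : ℕ → ℝ} (hr : ∀ n, 0 < r n) (hr0 : Filter.Tendsto r Filter.atTop (nhds 0)) :
    Filter.Tendsto (fun n => ∫ x in Ioi 0, ((x + r n) ^ (2 / 3 : ℝ) - r n ^ (2 / 3 : ℝ)) * c x t)
      Filter.atTop (nhds (lswEnergy c t)) := by
  refine tendsto_integral_of_dominated_convergence (fun x => x ^ (2 / 3 : ℝ) * c x t)
    (fun n => (h.integrable_energy_reg ht (hr n).le).1) (h.integrable_energy ht) (fun n => ?_) ?_
  · filter_upwards [ae_restrict_mem measurableSet_Ioi] with x hx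
    have := rpow_add_sub_mem (hr n).le hx
    rw [Real.norm_eq_abs, abs_mul, abs_of_nonneg (h.nonneg t ht x hx), abs_of_nonneg this.1]
    exact mul_le_mul_of_nonneg_right this.2 (h.nonneg t ht x hx)
  · filter_upwards [ae_restrict_mem measurableSet_Ioi] with x hx
    have h1 : Filter.Tendsto (fun n => (x + r n) ^ (2 / 3 : ℝ)) Filter.atTop
        (nhds ((x + 0) ^ (2 / 3 : ℝ))) :=
      (tendsto_const_nhds.add hr0).rpow_const (Or.inr (by norm_num))
    have h2 : Filter.Tendsto (fun n => r n ^ (2 / 3 : ℝ)) Filter.atTop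
        (nhds (0 ^ (2 / 3 : ℝ))) := hr0.rpow_const (Or.inr (by norm_num))
    rw [Real.zero_rpow (by norm_num)] at h2
    simpa using (h1.sub h2).mul_const (c x t)

theorem energy_antitoneOn (h : IsDiffusiveLSWSolution ε m c₀ c L) (hε : 0 < ε) (hε1 : ε ≤ 1) :
    AntitoneOn (lswEnergy c) (Ici 0) := by
  intro s hs t ht hst
  have hr0 := tendsto_one_div_add_atTop_nhds_zero_nat (𝕜 := ℝ)
  have hr : ∀ n : ℕ, (0 : ℝ) < 1 / ((n : ℝ) + 1) := fun n => by positivity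
  refine le_of_tendsto (h.tendsto_energy_reg ht hr hr0) (Filter.Eventually.of_forall fun n => ?_)
  refine le_trans ?_ (h.energy_reg_le hs (hr n).le)
  have h1 := (h.dissipation_identity hε hε1 hs hst (hr n)).2
  have h2 : 0 ≤ ∫ p, dissipation (1 / ((n : ℝ) + 1)) ε (L p.2) p.1 * c p.1 p.2
      ∂(stripMeasure s t) := by
    refine integral_nonneg_of_ae ?_
    filter_upwards [ae_stripMeasure_mem s t] with p hp
    have hp2 : 0 ≤ p.2 := (mem_Ici.1 hs).trans hp.2.1.le
    exact mul_nonneg (dissipation_nonneg (hr n).le hε (h.L_pos _ hp2) hp.1)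
      (h.nonneg _ hp2 _ hp.1)
  linarith

theorem aestronglyMeasurable_dissipation (h : IsDiffusiveLSWSolution ε m c₀ c L) {s t : ℝ}
    (hs : 0 ≤ s) (hst : s ≤ t) (δ : ℝ) :
    AEStronglyMeasurable (fun p : ℝ × ℝ => dissipation δ ε (L p.2) p.1 * c p.1 p.2)
      (stripMeasure s t) := by
  have hL := h.aemeasurable_L_strip (t := t) hs
  have e : AEMeasurable (fun p : ℝ × ℝ => p.1) (stripMeasure s t) := measurable_fst.aemeasurable
  refine AEStronglyMeasurable.mul ?_ (h.aestronglyMeasurable_strip hs hst)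
  unfold dissipation
  refine AEMeasurable.aestronglyMeasurable ?_
  exact (((((e.div_const ε).const_add 1).pow_const _).const_mul ε).const_mul _ |>.mul
    ((e.add_const δ).pow_const _)).add
    (((((e.div hL).pow_const _).const_sub 1).mul
      (((e.add_const δ).pow_const _).sub ((hL.add_const δ).pow_const _))).const_mul _)

/-- The total dissipation on a time interval is controlled by the initial energy. -/
theorem lintegral_dissipation_le (h : IsDiffusiveLSWSolution ε m c₀ c L) (hε : 0 < ε)
    (hε1 : ε ≤ 1) {s t : ℝ} (hs : 0 ≤ s) (hst : s ≤ t) :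
    ∫⁻ p, ENNReal.ofReal (dissipation 0 ε (L p.2) p.1 * c p.1 p.2) ∂(stripMeasure s t)
      ≤ ENNReal.ofReal (lswEnergy c s) := by
  have hr0 := tendsto_one_div_add_atTop_nhds_zero_nat (𝕜 := ℝ)
  have hr : ∀ n : ℕ, (0 : ℝ) < 1 / ((n : ℝ) + 1) := fun n => by positivity
  set r : ℕ → ℝ := fun n => 1 / ((n : ℝ) + 1) with hrdef
  have key : ∀ n, ∫⁻ p, ENNReal.ofReal (dissipation (r n) ε (L p.2) p.1 * c p.1 p.2)
      ∂(stripMeasure s t) ≤ ENNReal.ofReal (lswEnergy c s) := by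
    intro n
    obtain ⟨I, e⟩ := h.dissipation_identity hε hε1 hs hst (hr n)
    rw [← ofReal_integral_eq_lintegral_ofReal I, e]
    · refine ENNReal.ofReal_le_ofReal ?_
      have h1 := h.energy_reg_le hs (hr n).le
      have h2 := h.energy_reg_nonneg (hs.trans hst) (hr n).le
      linarith
    · filter_upwards [ae_stripMeasure_mem s t] with p hp
      have hp2 : 0 ≤ p.2 := hs.trans hp.2.1.le
      exact mul_nonneg (dissipation_nonneg (hr n).le hε (h.L_pos _ hp2) hp.1)
        (h.nonneg _ hp2 _ hp.1)
  calc ∫⁻ p, ENNReal.ofReal (dissipation 0 ε (L p.2) p.1 * c p.1 p.2) ∂(stripMeasure s t)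
      = ∫⁻ p, Filter.liminf (fun n =>
          ENNReal.ofReal (dissipation (r n) ε (L p.2) p.1 * c p.1 p.2)) Filter.atTop
          ∂(stripMeasure s t) := by
        refine lintegral_congr_ae ?_
        filter_upwards [ae_stripMeasure_mem s t] with p hp
        have hx := hp.1
        have hℓ := h.L_pos _ (hs.trans hp.2.1.le)
        have t1 : ∀ y q : ℝ, 0 < y → Filter.Tendsto (fun n => (y + r n) ^ q) Filter.atTop
            (nhds ((y + 0) ^ q)) := fun y q hy =>
          (tendsto_const_nhds.add hr0).rpow_const (Or.inl (by linarith))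
        refine (Filter.Tendsto.liminf_eq ?_).symm
        refine (ENNReal.continuous_ofReal.tendsto _).comp ?_
        refine Filter.Tendsto.mul_const _ ?_
        exact ((t1 _ _ hx).const_mul _).add
          ((((t1 _ _ hx).sub (t1 _ _ hℓ)).const_mul _).const_mul _)
    _ ≤ Filter.liminf (fun n => ∫⁻ p,
          ENNReal.ofReal (dissipation (r n) ε (L p.2) p.1 * c p.1 p.2) ∂(stripMeasure s t))
          Filter.atTop :=
        lintegral_liminf_le' fun n =>
          (h.aestronglyMeasurable_dissipation hs hst (r n)).aemeasurable.ennreal_ofReal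
    _ ≤ ENNReal.ofReal (lswEnergy c s) := by
        refine Filter.liminf_le_of_frequently_le' ?_
        exact Filter.Frequently.of_forall key

end IsDiffusiveLSWSolution

/-! ### A weighted bound for the dissipation -/

/-- On a sublevel set of `E` the integral of `D` is at most the level, if on each terminal
interval `(s,T]` it is at most `E s`. -/
theorem lintegral_sublevel_le {D : ℝ → ENNReal} {E : ℝ → ℝ} {T : ℝ}
    (hD : ∀ s ∈ Icc 0 T, ∫⁻ τ in Ioc s T, D τ ≤ ENNReal.ofReal (E s)) (y : ℝ) :
    ∫⁻ τ in {τ ∈ Ioc 0 T | E τ < y}, D τ ≤ ENNReal.ofReal y := by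
  set S := {τ ∈ Ioc 0 T | E τ < y} with hS
  rcases S.eq_empty_or_nonempty with h0 | h0
  · simp [h0]
  have hbdd : BddBelow S := ⟨0, fun τ hτ => hτ.1.1.le⟩
  obtain ⟨u, hu, hul, huS⟩ := exists_seq_tendsto_sInf h0 hbdd
  have hsub : S ⊆ {sInf S} ∪ ⋃ n, Ioc (u n) T := by
    intro τ hτ
    rcases (csInf_le hbdd hτ).eq_or_lt with h1 | h1
    · exact Or.inl h1.symm
    · obtain ⟨n, hn⟩ := (hul.eventually (Iio_mem_nhds h1)).exists
      exact Or.inr (mem_iUnion.2 ⟨n, hn, hτ.1.2⟩)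
  calc ∫⁻ τ in S, D τ ≤ ∫⁻ τ in {sInf S} ∪ ⋃ n, Ioc (u n) T, D τ := lintegral_mono_set hsub
    _ ≤ (∫⁻ τ in {sInf S}, D τ) + ∫⁻ τ in ⋃ n, Ioc (u n) T, D τ := lintegral_union_le _ _ _
    _ = ⨆ n, ∫⁻ τ in Ioc (u n) T, D τ := by
        rw [setLIntegral_measure_zero _ _ (by simp), zero_add, setLIntegral_iUnion_of_directed]
        exact (monotone_nat_of_le_succ fun n =>
          Ioc_subset_Ioc_left (hu n.le_succ)).directed_le
    _ ≤ ENNReal.ofReal y := by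
        refine iSup_le fun n => ?_
        have h1 := huS n
        exact (hD _ ⟨h1.1.1.le, h1.1.2⟩).trans (ENNReal.ofReal_le_ofReal h1.2.le)

theorem lintegral_Ioi_cube {b : ℝ} (hb : 0 < b) :
    ∫⁻ y in Ioi b, ENNReal.ofReal (2 * y ^ (-3 : ℝ)) = ENNReal.ofReal (1 / b ^ 2) := by
  rw [← ofReal_integral_eq_lintegral_ofReal]
  · rw [integral_const_mul, integral_Ioi_rpow_of_lt (by norm_num) hb]
    congr 1
    norm_num
    ring
  · exact (integrableOn_Ioi_rpow_of_lt (by norm_num) hb).const_mul 2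
  · filter_upwards [ae_restrict_mem measurableSet_Ioi] with y hy
    have : 0 < y := hb.trans hy
    show 0 ≤ 2 * y ^ (-3 : ℝ)
    positivity

theorem lintegral_Ioi_square {b : ℝ} (hb : 0 < b) :
    ∫⁻ y in Ioi b, ENNReal.ofReal (2 * y ^ (-2 : ℝ)) = ENNReal.ofReal (2 / b) := by
  rw [← ofReal_integral_eq_lintegral_ofReal]
  · rw [integral_const_mul, integral_Ioi_rpow_of_lt (by norm_num) hb]
    congr 1
    norm_num
    rw [Real.rpow_neg hb.le]
    norm_num
    ring
  · exact (integrableOn_Ioi_rpow_of_lt (by norm_num) hb).const_mul 2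
  · filter_upwards [ae_restrict_mem measurableSet_Ioi] with y hy
    have : 0 < y := hb.trans hy
    show 0 ≤ 2 * y ^ (-2 : ℝ)
    positivity

/-- An integrated form of `∫ (-E') / E² ≤ 1 / E(T)` (up to a factor `2`), with no regularity of
`E` beyond monotonicity: write `1 / E² = ∫_E^∞ 2 y⁻³ dy` and exchange the integrals. -/
theorem lintegral_div_sq_le {D : ℝ → ENNReal} {E : ℝ → ℝ} {T : ℝ} (hT : 0 ≤ T)
    (hE : AntitoneOn E (Icc 0 T)) (hpos : 0 < E T)
    (hDm : AEMeasurable D (volume.restrict (Ioc 0 T)))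
    (hEm : AEMeasurable E (volume.restrict (Ioc 0 T)))
    (hD : ∀ s ∈ Icc 0 T, ∫⁻ τ in Ioc s T, D τ ≤ ENNReal.ofReal (E s)) :
    ∫⁻ τ in Ioc 0 T, D τ * ENNReal.ofReal (1 / E τ ^ 2) ≤ ENNReal.ofReal (2 / E T) := by
  have hTm : T ∈ Icc 0 T := ⟨hT, le_rfl⟩
  have hge : ∀ τ ∈ Ioc 0 T, E T ≤ E τ := fun τ hτ => hE ⟨hτ.1.le, hτ.2⟩ hTm hτ.2
  let w : ℝ → ENNReal := fun y => ENNReal.ofReal (2 * y ^ (-3 : ℝ))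
  have hwm : Measurable w := by fun_prop
  have e1 : ∀ τ ∈ Ioc 0 T, D τ * ENNReal.ofReal (1 / E τ ^ 2)
      = ∫⁻ y in Ioi (E T), D τ * {q : ℝ × ℝ | E q.1 < q.2}.indicator (fun q => w q.2) (τ, y) := by
    intro τ hτ
    have hp : 0 < E τ := hpos.trans_le (hge τ hτ)
    have hm : Measurable (fun y =>
        {q : ℝ × ℝ | E q.1 < q.2}.indicator (fun q => w q.2) (τ, y)) := by
      have : (fun y => {q : ℝ × ℝ | E q.1 < q.2}.indicator (fun q => w q.2) (τ, y))
          = (Ioi (E τ)).indicator w := by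
        ext y; simp [indicator]
      rw [this]
      exact hwm.indicator measurableSet_Ioi
    rw [lintegral_const_mul _ hm, ← lintegral_Ioi_cube hp]
    congr 1
    have : (fun y => {q : ℝ × ℝ | E q.1 < q.2}.indicator (fun q => w q.2) (τ, y))
          = (Ioi (E τ)).indicator w := by
      ext y; simp [indicator]
    rw [this, setLIntegral_indicator measurableSet_Ioi,
      inter_eq_left.2 (Ioi_subset_Ioi (hge τ hτ))]
  rw [setLIntegral_congr_fun measurableSet_Ioc e1, lintegral_lintegral_swap]
  · calc ∫⁻ y in Ioi (E T), ∫⁻ τ in Ioc 0 T,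
          D τ * {q : ℝ × ℝ | E q.1 < q.2}.indicator (fun q => w q.2) (τ, y)
        ≤ ∫⁻ y in Ioi (E T), ENNReal.ofReal (2 * y ^ (-2 : ℝ)) := by
          refine setLIntegral_mono (by fun_prop) fun y hy => ?_
          have hy0 : 0 < y := hpos.trans hy
          have hEy : NullMeasurableSet {τ | E τ < y} (volume.restrict (Ioc 0 T)) :=
            nullMeasurableSet_lt hEm aemeasurable_const
          have e2 : (fun τ => D τ * {q : ℝ × ℝ | E q.1 < q.2}.indicator (fun q => w q.2) (τ, y))
              = {τ | E τ < y}.indicator (fun τ => D τ * w y) := by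
            ext τ; by_cases hτ : E τ < y <;> simp [indicator, hτ]
          rw [e2, lintegral_indicator₀ hEy]
          have e3 : (volume.restrict (Ioc 0 T)).restrict {τ | E τ < y}
              = volume.restrict {τ ∈ Ioc 0 T | E τ < y} := by
            rw [Measure.restrict_restrict₀ hEy]
            congr 1
            ext τ; simp [and_comm]
          rw [e3, lintegral_mul_const' _ _ ENNReal.ofReal_ne_top]
          calc (∫⁻ τ in {τ ∈ Ioc 0 T | E τ < y}, D τ) * w y
              ≤ ENNReal.ofReal y * w y := by
                gcongr
                exact lintegral_sublevel_le hD y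
            _ = ENNReal.ofReal (2 * y ^ (-2 : ℝ)) := by
                rw [← ENNReal.ofReal_mul hy0.le]
                congr 1
                have : y ^ (-2 : ℝ) = y ^ (1 : ℝ) * y ^ (-3 : ℝ) := by
                  rw [← Real.rpow_add hy0]; norm_num
                rw [this, Real.rpow_one]
                ring
      _ = ENNReal.ofReal (2 / E T) := lintegral_Ioi_square hpos
  · refine AEMeasurable.mul (hDm.comp_fst) ?_
    refine AEMeasurable.indicator₀ (hwm.comp measurable_snd).aemeasurable ?_
    exact nullMeasurableSet_lt hEm.comp_fst measurable_snd.aemeasurable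

/-! ### The truncated moment function -/

/-- A smooth substitute for the moment function `x^{4/3}`, to which it is comparable for
large `x`; it vanishes to second order at `0`. -/
noncomputable def momentFun (x : ℝ) : ℝ := (1 + x) ^ (4 / 3 : ℝ) - 1 - 4 / 3 * x

/-- The first derivative of `momentFun`. -/
noncomputable def momentFun₁ (x : ℝ) : ℝ := 4 / 3 * ((1 + x) ^ (1 / 3 : ℝ) - 1)

/-- The second derivative of `momentFun`. -/
noncomputable def momentFun₂ (x : ℝ) : ℝ := 4 / 9 * (1 + x) ^ (-(2 / 3) : ℝ)

/-- The bounded truncation `R f / (R + f)` of `f = momentFun`; it is a concave increasing function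
of `f`, so truncating only lowers the first two derivatives. -/
noncomputable def truncMoment (R x : ℝ) : ℝ := R * momentFun x / (R + momentFun x)

/-- The first derivative of `truncMoment R`. -/
noncomputable def truncMoment₁ (R x : ℝ) : ℝ := R ^ 2 * momentFun₁ x / (R + momentFun x) ^ 2

/-- The second derivative of `truncMoment R`. -/
noncomputable def truncMoment₂ (R x : ℝ) : ℝ :=
  R ^ 2 * momentFun₂ x / (R + momentFun x) ^ 2
    - 2 * R ^ 2 * momentFun₁ x ^ 2 / (R + momentFun x) ^ 3

theorem momentFun_nonneg {x : ℝ} (hx : -1 ≤ x) : 0 ≤ momentFun x := by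
  have := one_add_mul_self_le_rpow_one_add hx (p := (4 / 3 : ℝ)) (by norm_num)
  unfold momentFun
  linarith

theorem hasDerivAt_momentFun {x : ℝ} (hx : 0 < x) : HasDerivAt momentFun (momentFun₁ x) x := by
  have h1 : HasDerivAt (fun x : ℝ => 1 + x) 1 x := (hasDerivAt_id x).const_add 1
  have h2 := ((h1.rpow_const (p := (4 / 3 : ℝ)) (Or.inl (by linarith))).sub_const 1).sub
    ((hasDerivAt_id x).const_mul (4 / 3 : ℝ))
  refine h2.congr_deriv ?_
  unfold momentFun₁
  norm_num
  ring

theorem hasDerivAt_momentFun₁ {x : ℝ} (hx : 0 < x) : HasDerivAt momentFun₁ (momentFun₂ x) x := by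
  have h1 : HasDerivAt (fun x : ℝ => 1 + x) 1 x := (hasDerivAt_id x).const_add 1
  have h2 := ((h1.rpow_const (p := (1 / 3 : ℝ)) (Or.inl (by linarith))).sub_const 1).const_mul
    (4 / 3 : ℝ)
  refine h2.congr_deriv ?_
  unfold momentFun₂
  norm_num
  ring

theorem momentFun₁_nonneg {x : ℝ} (hx : 0 < x) : 0 ≤ momentFun₁ x := by
  have : 1 ≤ (1 + x) ^ (1 / 3 : ℝ) := Real.one_le_rpow (by linarith) (by norm_num)
  unfold momentFun₁
  linarith

theorem momentFun₁_le {x : ℝ} (hx : 0 < x) : momentFun₁ x ≤ 4 / 3 * x ^ (1 / 3 : ℝ) := by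
  have := Real.rpow_add_le_add_rpow zero_le_one hx.le (p := (1 / 3 : ℝ)) (by norm_num)
    (by norm_num)
  rw [Real.one_rpow] at this
  unfold momentFun₁
  linarith

/-- With `w = (1 + x)^{1/3}` this is `(16/9) (w - 1)² ≤ (w - 1)² (w² + 2w/3 + 1/3)`; it makes the
derivatives of `truncMoment R` bounded. -/
theorem momentFun₁_sq_le {x : ℝ} (hx : 0 < x) : momentFun₁ x ^ 2 ≤ momentFun x := by
  have hw1 : 1 ≤ (1 + x) ^ (1 / 3 : ℝ) := Real.one_le_rpow (by linarith) (by norm_num)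
  have e3 : ((1 + x) ^ (1 / 3 : ℝ)) ^ 3 = 1 + x := by
    rw [← Real.rpow_mul_natCast (by linarith)]; norm_num
  have e4 : (1 + x) ^ (4 / 3 : ℝ) = ((1 + x) ^ (1 / 3 : ℝ)) ^ 4 := by
    rw [← Real.rpow_mul_natCast (by linarith)]; norm_num
  unfold momentFun₁ momentFun
  rw [e4]
  set w := (1 + x) ^ (1 / 3 : ℝ)
  have : x = w ^ 3 - 1 := by linarith
  rw [this]
  have key : w ^ 4 - 1 - 4 / 3 * (w ^ 3 - 1) - (4 / 3 * (w - 1)) ^ 2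
      = (w - 1) ^ 2 * (w ^ 2 + 2 / 3 * w + 1 / 3 - 16 / 9) := by ring
  have : 0 ≤ (w - 1) ^ 2 * (w ^ 2 + 2 / 3 * w + 1 / 3 - 16 / 9) :=
    mul_nonneg (sq_nonneg _) (by nlinarith)
  linarith

theorem momentFun₂_nonneg {x : ℝ} (hx : 0 < x) : 0 ≤ momentFun₂ x := by
  have : 0 < 1 + x := by linarith
  unfold momentFun₂
  positivity

theorem momentFun₂_le {x : ℝ} (hx : 0 < x) :
    momentFun₂ x ≤ 4 / 9 ∧ momentFun₂ x ≤ 4 / 9 * x ^ (-(2 / 3) : ℝ) := by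
  have h1 : (1 + x) ^ (-(2 / 3) : ℝ) ≤ 1 :=
    Real.rpow_le_one_of_one_le_of_nonpos (by linarith) (by norm_num)
  have h2 : (1 + x) ^ (-(2 / 3) : ℝ) ≤ x ^ (-(2 / 3) : ℝ) :=
    Real.rpow_le_rpow_of_nonpos hx (by linarith) (by norm_num)
  unfold momentFun₂
  constructor <;> linarith

theorem momentFun_le {x : ℝ} (hx : 0 < x) : momentFun x ≤ 4 * (1 + x ^ (4 / 3 : ℝ)) := by
  have hp : 0 < x ^ (4 / 3 : ℝ) := by positivity
  have h2 : (2 : ℝ) ^ (4 / 3 : ℝ) ≤ 4 := by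
    calc (2 : ℝ) ^ (4 / 3 : ℝ) ≤ 2 ^ (2 : ℝ) :=
          Real.rpow_le_rpow_of_exponent_le (by norm_num) (by norm_num)
      _ = 4 := by norm_num
  have : (1 + x) ^ (4 / 3 : ℝ) ≤ 4 * (1 + x ^ (4 / 3 : ℝ)) := by
    rcases le_total x 1 with h | h
    · calc (1 + x) ^ (4 / 3 : ℝ) ≤ 2 ^ (4 / 3 : ℝ) := by gcongr; linarith
        _ ≤ 4 * (1 + x ^ (4 / 3 : ℝ)) := by linarith
    · calc (1 + x) ^ (4 / 3 : ℝ) ≤ (2 * x) ^ (4 / 3 : ℝ) := by gcongr; linarith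
        _ = 2 ^ (4 / 3 : ℝ) * x ^ (4 / 3 : ℝ) := Real.mul_rpow (by norm_num) hx.le
        _ ≤ 4 * x ^ (4 / 3 : ℝ) := by gcongr
        _ ≤ 4 * (1 + x ^ (4 / 3 : ℝ)) := by linarith
  unfold momentFun
  linarith

theorem rpow_le_momentFun {x : ℝ} (hx : 0 < x) :
    x ^ (4 / 3 : ℝ) ≤ momentFun x + 4 / 3 * x := by
  have := Real.add_rpow_le_rpow_add zero_le_one hx.le (p := (4 / 3 : ℝ)) (by norm_num)
  rw [Real.one_rpow] at this
  unfold momentFun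
  linarith

theorem truncMoment_nonneg {R x : ℝ} (hR : 1 ≤ R) (hx : 0 < x) : 0 ≤ truncMoment R x := by
  have := momentFun_nonneg (x := x) (by linarith)
  unfold truncMoment
  positivity

theorem truncMoment_le {R x : ℝ} (hR : 1 ≤ R) (hx : 0 < x) : truncMoment R x ≤ momentFun x := by
  have h0 := momentFun_nonneg (x := x) (by linarith)
  unfold truncMoment
  rw [div_le_iff₀ (by linarith)]
  nlinarith

theorem truncMoment₁_nonneg {R x : ℝ} (hx : 0 < x) : 0 ≤ truncMoment₁ R x := by
  have := momentFun₁_nonneg hx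
  unfold truncMoment₁
  positivity

theorem sq_div_sq_le_one {R y : ℝ} (hR : 1 ≤ R) (hy : 0 ≤ y) : R ^ 2 / (R + y) ^ 2 ≤ 1 :=
  div_le_one_of_le₀ (by gcongr; linarith) (by positivity)

theorem truncMoment₁_le {R x : ℝ} (hR : 1 ≤ R) (hx : 0 < x) :
    truncMoment₁ R x ≤ momentFun₁ x := by
  have h0 := momentFun_nonneg (x := x) (by linarith)
  have h1 := momentFun₁_nonneg hx
  calc truncMoment₁ R x = R ^ 2 / (R + momentFun x) ^ 2 * momentFun₁ x := by
        unfold truncMoment₁; ring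
    _ ≤ 1 * momentFun₁ x := by gcongr; exact sq_div_sq_le_one hR h0
    _ = momentFun₁ x := one_mul _

theorem truncMoment₂_le {R x : ℝ} (hR : 1 ≤ R) (hx : 0 < x) :
    truncMoment₂ R x ≤ momentFun₂ x := by
  have h0 := momentFun_nonneg (x := x) (by linarith)
  have h2 := momentFun₂_nonneg hx
  have h3 : 0 ≤ 2 * R ^ 2 * momentFun₁ x ^ 2 / (R + momentFun x) ^ 3 := by positivity
  calc truncMoment₂ R x ≤ R ^ 2 * momentFun₂ x / (R + momentFun x) ^ 2 := by
        unfold truncMoment₂; linarith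
    _ = R ^ 2 / (R + momentFun x) ^ 2 * momentFun₂ x := by ring
    _ ≤ 1 * momentFun₂ x := by gcongr; exact sq_div_sq_le_one hR h0
    _ = momentFun₂ x := one_mul _

theorem truncMoment₁_le_const {R x : ℝ} (hR : 1 ≤ R) (hx : 0 < x) : truncMoment₁ R x ≤ R := by
  have h0 := momentFun_nonneg (x := x) (by linarith)
  have hs := momentFun₁_sq_le hx
  unfold truncMoment₁
  rw [div_le_iff₀ (by positivity)]
  have h1 : momentFun₁ x ≤ R + momentFun x := by nlinarith [sq_nonneg (momentFun₁ x - 1)]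
  have h2 : R ≤ R + momentFun x := by linarith
  calc R ^ 2 * momentFun₁ x = R * (R * momentFun₁ x) := by ring
    _ ≤ R * ((R + momentFun x) * (R + momentFun x)) := by
        have := momentFun₁_nonneg hx
        gcongr
    _ = R * (R + momentFun x) ^ 2 := by ring

theorem neg_two_le_truncMoment₂ {R x : ℝ} (hR : 1 ≤ R) (hx : 0 < x) :
    -2 ≤ truncMoment₂ R x := by
  have h0 := momentFun_nonneg (x := x) (by linarith)
  have h2 := momentFun₂_nonneg hx
  have hs := momentFun₁_sq_le hx
  have h3 : 2 * R ^ 2 * momentFun₁ x ^ 2 / (R + momentFun x) ^ 3 ≤ 2 := by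
    rw [div_le_iff₀ (by positivity)]
    calc 2 * R ^ 2 * momentFun₁ x ^ 2
        ≤ 2 * (R + momentFun x) ^ 2 * (R + momentFun x) := by
          gcongr <;> linarith
      _ = 2 * (R + momentFun x) ^ 3 := by ring
  have h4 : 0 ≤ R ^ 2 * momentFun₂ x / (R + momentFun x) ^ 2 := by positivity
  unfold truncMoment₂
  linarith

theorem isLipschitzTest_truncMoment {R : ℝ} (hR : 1 ≤ R) :
    IsLipschitzTest (truncMoment R) (truncMoment₁ R) (truncMoment₂ R) 1 (R + 2) where
  d_pos := one_pos
  smooth := by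
    intro x hx
    have hx' : -1 < x := hx
    have h1 : ContDiffAt ℝ ∞ momentFun x :=
      (((contDiffAt_const.add contDiffAt_id).rpow_const_of_ne
        (by simp only [id]; linarith)).sub contDiffAt_const).sub
        (contDiffAt_const.mul contDiffAt_id)
    have h0 := momentFun_nonneg hx'.le
    exact ((contDiffAt_const.mul h1).div (contDiffAt_const.add h1)
      (by positivity)).contDiffWithinAt
  zero := by simp [truncMoment, momentFun]
  hasDeriv₁ x hx := by
    have h0 := momentFun_nonneg (x := x) (by linarith)
    have hd := hasDerivAt_momentFun hx
    have hne : R + momentFun x ≠ 0 := by positivity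
    refine ((hd.const_mul R).div (hd.const_add R) hne).congr_deriv ?_
    unfold truncMoment₁
    congr 1
    ring
  hasDeriv₂ x hx := by
    have h0 := momentFun_nonneg (x := x) (by linarith)
    have hd := hasDerivAt_momentFun hx
    have hd' := hasDerivAt_momentFun₁ hx
    have hne : R + momentFun x ≠ 0 := by positivity
    refine ((hd'.const_mul (R ^ 2)).div ((hd.const_add R).pow 2) (pow_ne_zero 2 hne)).congr_deriv ?_
    unfold truncMoment₂
    simp only [Pi.pow_apply, Nat.cast_ofNat, Nat.add_one_sub_one, pow_one]
    field_simp
  bound₁ x hx := by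
    rw [abs_of_nonneg (truncMoment₁_nonneg hx)]
    linarith [truncMoment₁_le_const hR hx]
  bound₂ x hx := by
    rw [abs_le]
    have := truncMoment₂_le hR hx
    have := (momentFun₂_le hx).1
    have := neg_two_le_truncMoment₂ hR hx
    constructor <;> linarith

theorem tendsto_truncMoment (x : ℝ) :
    Filter.Tendsto (fun n : ℕ => truncMoment ((n : ℝ) + 1) x) Filter.atTop
      (nhds (momentFun x)) := by
  have h0 := tendsto_one_div_add_atTop_nhds_zero_nat (𝕜 := ℝ)
  have h1 : Filter.Tendsto (fun n : ℕ => momentFun x / (1 + 1 / ((n : ℝ) + 1) * momentFun x))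
      Filter.atTop (nhds (momentFun x / (1 + 0 * momentFun x))) :=
    tendsto_const_nhds.div (tendsto_const_nhds.add (h0.mul_const _)) (by simp)
  simp only [zero_mul, add_zero, div_one] at h1
  refine h1.congr fun n => ?_
  have hn : (n : ℝ) + 1 ≠ 0 := by positivity
  unfold truncMoment
  rw [show (1 : ℝ) + 1 / ((n : ℝ) + 1) * momentFun x
      = ((n : ℝ) + 1 + momentFun x) / ((n : ℝ) + 1) by
    field_simp, div_div_eq_mul_div, mul_comm]

/-- The growth of the moment is controlled by the dissipation: a pointwise form, with a free
parameter `κ`, of the differential inequality `H' ≲ √D + D`. The drift and, for `x ≥ 1`,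
the diffusion are treated by Young's inequality; for `x ≤ 1` the diffusion is directly bounded by
the diffusive part of the dissipation. -/
theorem lswGen_truncMoment_le {ε ℓ κ R x : ℝ} (hε : 0 < ε) (hε1 : ε ≤ 1) (hℓ : 0 < ℓ)
    (hκ : 0 < κ) (hR : 1 ≤ R) (hx : 0 < x) :
    lswGen ε ℓ (truncMoment₁ R) (truncMoment₂ R) x
      ≤ 2 * (1 / κ * dissipation 0 ε ℓ x + dissipation 0 ε ℓ x + κ * x) := by
  have f1n := truncMoment₁_nonneg (R := R) hx
  have f1 := (truncMoment₁_le hR hx).trans (momentFun₁_le hx)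
  have f2 := (truncMoment₂_le hR hx).trans (momentFun₂_le hx).1
  have f2' := (truncMoment₂_le hR hx).trans (momentFun₂_le hx).2
  have ha := diffusion_nonneg hε hx
  have ha' := diffusion_le hε hε1 hx
  unfold lswGen dissipation
  rw [add_zero, add_zero, Real.div_rpow hx.le hℓ.le, Real.rpow_neg hx.le, Real.rpow_neg hx.le,
    Real.rpow_neg hℓ.le]
  rw [Real.rpow_neg hx.le] at f2'
  generalize truncMoment₁ R x = φ₁ at *
  generalize truncMoment₂ R x = φ₂ at *
  generalize ε * (1 + x / ε) ^ (1 / 3 : ℝ) = a at *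
  have hu : 0 < x ^ (1 / 3 : ℝ) := by positivity
  have hv : 0 < ℓ ^ (1 / 3 : ℝ) := by positivity
  have e2 : x ^ (2 / 3 : ℝ) = (x ^ (1 / 3 : ℝ)) ^ 2 := by
    rw [← Real.rpow_mul_natCast hx.le]; norm_num
  have e3 : x = (x ^ (1 / 3 : ℝ)) ^ 3 := by
    rw [← Real.rpow_mul_natCast hx.le]; norm_num
  have e4 : x ^ (4 / 3 : ℝ) = (x ^ (1 / 3 : ℝ)) ^ 4 := by
    rw [← Real.rpow_mul_natCast hx.le]; norm_num
  rw [e2] at f2'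
  rw [e4]
  generalize x ^ (1 / 3 : ℝ) = u at *
  generalize ℓ ^ (1 / 3 : ℝ) = v at *
  set q := 1 - u / v with hq
  have hP2 : q * (u⁻¹ - v⁻¹) = q ^ 2 / u := by
    rw [hq]; field_simp
  rw [hP2]
  have hdrift : -(q * φ₁) ≤ 1 / κ * (q ^ 2 / u) + 4 / 9 * (κ * x) := by
    have h1 : -(q * φ₁) ≤ |q| * (4 / 3 * u) :=
      calc -(q * φ₁) ≤ |q * φ₁| := neg_le_abs _
        _ = |q| * φ₁ := by rw [abs_mul, abs_of_nonneg f1n]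
        _ ≤ |q| * (4 / 3 * u) := by gcongr
    have h2 : 1 / κ * (q ^ 2 / u) + 4 / 9 * (κ * x) - |q| * (4 / 3 * u)
        = (|q| - 2 / 3 * κ * u ^ 2) ^ 2 / (κ * u) := by
      rw [← sq_abs q, e3]; field_simp; ring
    have h3 : 0 ≤ (|q| - 2 / 3 * κ * u ^ 2) ^ 2 / (κ * u) := by positivity
    linarith
  set P := 2 / 9 * a * (u ^ 4)⁻¹ with hP
  have hPn : 0 ≤ P := by positivity
  have hdiff : a * φ₂ ≤ 1 / κ * P + 2 * P + 4 / 9 * (κ * x) := by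
    have hκP : 0 ≤ 1 / κ * P := by positivity
    have hκx : 0 ≤ κ * x := by positivity
    rcases le_total x 1 with h | h
    · have hu1 : u ^ 4 ≤ 1 := by
        have : u ≤ 1 := by
          by_contra hc
          push Not at hc
          have : 1 < u ^ 3 := one_lt_pow₀ hc (by norm_num)
          linarith
        exact pow_le_one₀ hu.le this
      have h1 : 1 ≤ (u ^ 4)⁻¹ := (one_le_inv₀ (by positivity)).2 hu1
      have h2 : a * φ₂ ≤ a * (4 / 9) := by gcongr
      have h3 : a * (4 / 9) * 1 ≤ a * (4 / 9) * (u ^ 4)⁻¹ := by gcongr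
      have h4 : a * (4 / 9) * (u ^ 4)⁻¹ = 2 * P := by rw [hP]; ring
      linarith
    · have h1 : a * φ₂ ≤ a * (4 / 9 * (u ^ 2)⁻¹) := by gcongr
      have h2 : 1 / κ * P + 2 / 9 * (a * κ) - a * (4 / 9 * (u ^ 2)⁻¹)
          = 2 / 9 * a * ((u ^ 2)⁻¹ - κ) ^ 2 / κ := by
        rw [hP]; field_simp; ring
      have h3 : 0 ≤ 2 / 9 * a * ((u ^ 2)⁻¹ - κ) ^ 2 / κ := by positivity
      have h4 : a * κ ≤ 2 * x * κ := by gcongr; linarith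
      nlinarith
  have hS : 0 ≤ q ^ 2 / u := by positivity
  have hSκ : 0 ≤ 1 / κ * (q ^ 2 / u) := by positivity
  have hκx : 0 ≤ κ * x := by positivity
  have hκP : 0 ≤ 1 / κ * P := by positivity
  have e : 1 / κ * (P + 2 / 3 * (q ^ 2 / u)) = 1 / κ * P + 2 / 3 * (1 / κ * (q ^ 2 / u)) := by
    ring
  rw [e]
  linarith

/-! ### Positivity and square integrability of the energy -/

theorem ofReal_integral_le_lintegral_ofReal {α : Type*} [MeasurableSpace α] {μ : Measure α}
    {g : α → ℝ} (hg : Integrable g μ) :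
    ENNReal.ofReal (∫ a, g a ∂μ) ≤ ∫⁻ a, ENNReal.ofReal (g a) ∂μ := by
  have h1 : ∫ a, g a ∂μ ≤ ∫ a, max (g a) 0 ∂μ :=
    integral_mono hg hg.pos_part fun a => le_max_left _ _
  refine (ENNReal.ofReal_le_ofReal h1).trans (le_of_eq ?_)
  rw [ofReal_integral_eq_lintegral_ofReal hg.pos_part
    (Filter.Eventually.of_forall fun a => le_max_right _ _)]
  simp [ENNReal.ofReal_max]

namespace IsDiffusiveLSWSolution

variable {ε m : ℝ} {c₀ : ℝ → ℝ} {c : ℝ → ℝ → ℝ} {L : ℝ → ℝ}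

theorem integrable_mass (h : IsDiffusiveLSWSolution ε m c₀ c L) {t : ℝ} (ht : 0 ≤ t) :
    IntegrableOn (fun x => x * c x t) (Ioi 0) := by
  refine h.integrable_mul_slice ht (K := 1) (Measurable.aestronglyMeasurable (by fun_prop)) ?_
  intro x hx
  rw [abs_of_pos hx]
  linarith

theorem energy_pos (h : IsDiffusiveLSWSolution ε 1 c₀ c L) {t : ℝ} (ht : 0 ≤ t) :
    0 < lswEnergy c t := by
  have hn : 0 ≤ᵐ[volume.restrict (Ioi 0)] fun x => x ^ (2 / 3 : ℝ) * c x t := by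
    filter_upwards [ae_restrict_mem measurableSet_Ioi] with x hx
    have := h.nonneg t ht x hx
    have hx' : 0 < x := hx
    show 0 ≤ x ^ (2 / 3 : ℝ) * c x t
    positivity
  refine lt_of_le_of_ne (integral_nonneg_of_ae hn) fun h0 => ?_
  have h1 := (integral_eq_zero_iff_of_nonneg_ae hn (h.integrable_energy ht)).1 h0.symm
  have h2 : ∫ x in Ioi 0, x * c x t = 0 := by
    refine integral_eq_zero_of_ae ?_
    filter_upwards [h1, ae_restrict_mem measurableSet_Ioi] with x hx hx0
    have hp : x ^ (2 / 3 : ℝ) ≠ 0 := (Real.rpow_pos_of_pos hx0 _).ne'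
    have : c x t = 0 := (mul_eq_zero.1 hx).resolve_left hp
    simp [this]
  rw [h.mass t ht] at h2
  exact one_ne_zero h2

theorem intervalIntegrable_energy_sq (h : IsDiffusiveLSWSolution ε 1 c₀ c L) (hε : 0 < ε)
    (hε1 : ε ≤ 1) {T : ℝ} (hT : 0 ≤ T) :
    IntervalIntegrable (fun t => lswEnergy c t ^ 2) volume 0 T := by
  refine AntitoneOn.intervalIntegrable fun s hs t ht hst => ?_
  rw [uIcc_of_le hT] at hs ht
  have := h.energy_antitoneOn hε hε1 hs.1 ht.1 hst
  have := (h.energy_pos ht.1).le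
  show lswEnergy c t ^ 2 ≤ lswEnergy c s ^ 2
  gcongr

theorem mul_energy_sq_le (h : IsDiffusiveLSWSolution ε 1 c₀ c L) (hε : 0 < ε)
    (hε1 : ε ≤ 1) {T : ℝ} (hT : 0 ≤ T) :
    T * lswEnergy c T ^ 2 ≤ ∫ t in (0 : ℝ)..T, lswEnergy c t ^ 2 := by
  have h1 : ∫ _ in (0 : ℝ)..T, lswEnergy c T ^ 2 ≤ ∫ t in (0 : ℝ)..T, lswEnergy c t ^ 2 := by
    refine intervalIntegral.integral_mono_on hT intervalIntegrable_const
      (h.intervalIntegrable_energy_sq hε hε1 hT) fun t ht => ?_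
    have := h.energy_antitoneOn hε hε1 (mem_Ici.2 ht.1) (mem_Ici.2 hT) ht.2
    have := (h.energy_pos hT).le
    gcongr
  simpa using h1

/-! ### Growth of the moment against the energy -/

/-- Bound for the growth of the truncated moment, uniform in the truncation. The free parameter
of `lswGen_truncMoment_le` is chosen as `κ = 8 E²`, so that `∫ D / κ` is
controlled by `1 / E(T)`, with a constant small enough to be absorbed later. -/
theorem truncMoment_growth (h : IsDiffusiveLSWSolution ε 1 c₀ c L) (hε : 0 < ε)
    (hε1 : ε ≤ 1) {T R : ℝ} (hT : 0 ≤ T) (hR : 1 ≤ R) :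
    (∫ x in Ioi 0, truncMoment R x * c x T) - ∫ x in Ioi 0, truncMoment R x * c x 0
      ≤ 1 / (2 * lswEnergy c T) + 2 * lswEnergy c 0
        + 16 * ∫ t in (0 : ℝ)..T, lswEnergy c t ^ 2 := by
  set E := lswEnergy c
  have hEpos : ∀ t, 0 ≤ t → 0 < E t := fun t ht => h.energy_pos ht
  have hanti : AntitoneOn E (Icc 0 T) :=
    (h.energy_antitoneOn hε hε1).mono fun t ht => ht.1
  have hEm : AEMeasurable E (volume.restrict (Ioc 0 T)) :=
    aemeasurable_restrict_of_antitoneOn measurableSet_Ioc (hanti.mono Ioc_subset_Icc_self)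
  have hf := isLipschitzTest_truncMoment hR
  have I := h.integrable_lswGen_mul_strip hε hε1 le_rfl hT hf.aemeasurable₁ hf.aemeasurable₂
      hf.bound₁ hf.bound₂
  let P : ℝ × ℝ → ENNReal := fun p => ENNReal.ofReal (dissipation 0 ε (L p.2) p.1 * c p.1 p.2)
  let D : ℝ → ENNReal := fun τ => ∫⁻ x in Ioi 0, P (x, τ)
  have hPm : ∀ s, 0 ≤ s → s ≤ T → AEMeasurable P (stripMeasure s T) := fun s hs hsT =>
    (h.aestronglyMeasurable_dissipation hs hsT 0).aemeasurable.ennreal_ofReal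
  have hDm : AEMeasurable D (volume.restrict (Ioc 0 T)) :=
    (hPm 0 le_rfl hT).lintegral_prod_left'
  have hD : ∀ s ∈ Icc 0 T, ∫⁻ τ in Ioc s T, D τ ≤ ENNReal.ofReal (E s) := by
    intro s hs
    have h1 := h.lintegral_dissipation_le hε hε1 hs.1 hs.2
    rwa [stripMeasure, lintegral_prod_symm _ (hPm s hs.1 hs.2)] at h1
  have hDE := lintegral_div_sq_le hT hanti (hEpos T hT) hDm hEm hD
  let M : ℝ × ℝ → ENNReal := fun p => ENNReal.ofReal (p.1 * c p.1 p.2)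
  have hMm : AEMeasurable M (stripMeasure 0 T) :=
    ((measurable_fst.aemeasurable).mul
      (h.aestronglyMeasurable_strip le_rfl hT).aemeasurable).ennreal_ofReal
  have hM : ∀ τ, 0 ≤ τ → ∫⁻ x in Ioi 0, M (x, τ) = 1 := by
    intro τ hτ
    have e := ofReal_integral_eq_lintegral_ofReal (h.integrable_mass hτ) (by
      filter_upwards [ae_restrict_mem measurableSet_Ioi] with x hx
      exact mul_nonneg (le_of_lt hx) (h.nonneg τ hτ x hx))
    rw [h.mass τ hτ, ENNReal.ofReal_one] at e
    exact e.symm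
  let A : ℝ → ENNReal := fun τ => ENNReal.ofReal (1 / E τ ^ 2)
  let B : ℝ → ENNReal := fun τ => ENNReal.ofReal (E τ ^ 2)
  have hAm : AEMeasurable A (volume.restrict (Ioc 0 T)) :=
    ((hEm.pow_const 2).const_div 1).ennreal_ofReal
  have hBm : AEMeasurable B (volume.restrict (Ioc 0 T)) := (hEm.pow_const 2).ennreal_ofReal
  have hAm' : AEMeasurable (fun p : ℝ × ℝ => A p.2) (stripMeasure 0 T) := hAm.comp_snd
  have hBm' : AEMeasurable (fun p : ℝ × ℝ => B p.2) (stripMeasure 0 T) := hBm.comp_snd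
  have hP0 := hPm 0 le_rfl hT
  have hMB : AEMeasurable (fun p : ℝ × ℝ => M p * B p.2) (stripMeasure 0 T) := hMm.mul hBm'
  have hPA : AEMeasurable (fun p : ℝ × ℝ => P p * A p.2) (stripMeasure 0 T) := hP0.mul hAm'
  set J := ∫ t in (0 : ℝ)..T, E t ^ 2 with hJ
  have hJn : 0 ≤ J := intervalIntegral.integral_nonneg hT fun t _ => sq_nonneg _
  -- The three terms of the pointwise bound, with `κ = 8 E²`: here `A = 1 / E²`, `B = E²`.
  have hint : ∫⁻ p, (ENNReal.ofReal (1 / 4) * (P p * A p.2) + ENNReal.ofReal 2 * P p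
      + ENNReal.ofReal 16 * (M p * B p.2)) ∂(stripMeasure 0 T)
      ≤ ENNReal.ofReal (1 / 4) * ENNReal.ofReal (2 / E T) + ENNReal.ofReal 2 * ENNReal.ofReal (E 0)
        + ENNReal.ofReal 16 * ENNReal.ofReal J := by
    rw [lintegral_add_right' _ (hMB.const_mul _), lintegral_add_right' _ (hP0.const_mul _),
      lintegral_const_mul' _ _ ENNReal.ofReal_ne_top,
      lintegral_const_mul' _ _ ENNReal.ofReal_ne_top,
      lintegral_const_mul' _ _ ENNReal.ofReal_ne_top]
    have i1 : ∫⁻ p, P p * A p.2 ∂(stripMeasure 0 T) ≤ ENNReal.ofReal (2 / E T) := by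
      rw [stripMeasure, lintegral_prod_symm _ hPA]
      refine le_trans (le_of_eq ?_) hDE
      congr 1
      ext τ
      exact lintegral_mul_const' (A τ) _ ENNReal.ofReal_ne_top
    have i2 : ∫⁻ p, P p ∂(stripMeasure 0 T) ≤ ENNReal.ofReal (E 0) :=
      h.lintegral_dissipation_le hε hε1 le_rfl hT
    have i3 : ∫⁻ p, M p * B p.2 ∂(stripMeasure 0 T) = ENNReal.ofReal J := by
      rw [stripMeasure, lintegral_prod_symm _ hMB, hJ,
        intervalIntegral.integral_of_le hT, ofReal_integral_eq_lintegral_ofReal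
          ((intervalIntegrable_iff_integrableOn_Ioc_of_le hT).1
            (h.intervalIntegrable_energy_sq hε hε1 hT))
          (Filter.Eventually.of_forall fun t => sq_nonneg _)]
      refine setLIntegral_congr_fun measurableSet_Ioc fun τ hτ => ?_
      dsimp only
      rw [lintegral_mul_const' _ _ ENNReal.ofReal_ne_top, hM τ hτ.1.le, one_mul]
    rw [i3]
    gcongr
  have hpt : ∫⁻ p, ENNReal.ofReal (lswGen ε (L p.2) (truncMoment₁ R) (truncMoment₂ R) p.1
      * c p.1 p.2) ∂(stripMeasure 0 T)
      ≤ ∫⁻ p, (ENNReal.ofReal (1 / 4) * (P p * A p.2) + ENNReal.ofReal 2 * P p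
      + ENNReal.ofReal 16 * (M p * B p.2)) ∂(stripMeasure 0 T) := by
    refine lintegral_mono_ae ?_
    filter_upwards [ae_stripMeasure_mem 0 T] with p hp
    have hx := hp.1
    have hτ := hp.2.1.le
    have hc := h.nonneg _ hτ _ hx
    have hd := dissipation_nonneg le_rfl hε (h.L_pos _ hτ) hx
    have hEp := hEpos _ hτ
    have key := lswGen_truncMoment_le hε hε1 (h.L_pos _ hτ) (κ := 8 * E p.2 ^ 2) (by positivity)
      hR hx
    simp only [P, A, M, B]
    rw [← ENNReal.ofReal_mul (by positivity), ← ENNReal.ofReal_mul (by positivity),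
      ← ENNReal.ofReal_mul (by positivity), ← ENNReal.ofReal_mul (by positivity),
      ← ENNReal.ofReal_mul (by positivity), ← ENNReal.ofReal_add (by positivity) (by positivity),
      ← ENNReal.ofReal_add (by positivity) (by positivity)]
    refine ENNReal.ofReal_le_ofReal ((mul_le_mul_of_nonneg_right key hc).trans (le_of_eq ?_))
    field_simp
    ring
  have hEpT := hEpos T hT
  have hEp0 := hEpos 0 le_rfl
  have hfin := (ofReal_integral_le_lintegral_ofReal I).trans (hpt.trans hint)
  rw [← h.weak_eq_strip hε hε1 hf le_rfl hT, ← ENNReal.ofReal_mul (by positivity),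
    ← ENNReal.ofReal_mul (by positivity), ← ENNReal.ofReal_mul (by positivity),
    ← ENNReal.ofReal_add (by positivity) (by positivity),
    ← ENNReal.ofReal_add (by positivity) (by positivity),
    ENNReal.ofReal_le_ofReal_iff (by positivity)] at hfin
  refine hfin.trans (le_of_eq ?_)
  field_simp
  ring

/-! ### Initial bounds and interpolation -/

theorem moment_bounds_initial (h : IsDiffusiveLSWSolution ε 1 c₀ c L) {M₀ : ℝ}
    (hint : IntegrableOn (fun x => (1 + x ^ (4 / 3 : ℝ)) * c₀ x) (Ioi 0))
    (hM₀ : ∫ x in Ioi 0, (1 + x ^ (4 / 3 : ℝ)) * c₀ x = M₀) :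
    1 ≤ M₀ ∧ lswEnergy c 0 ≤ M₀ ∧
      ∀ R, 1 ≤ R → ∫ x in Ioi 0, truncMoment R x * c x 0 ≤ 4 * M₀ := by
  have e : EqOn (fun x => (1 + x ^ (4 / 3 : ℝ)) * c₀ x) (fun x => (1 + x ^ (4 / 3 : ℝ)) * c x 0)
      (Ioi 0) := fun x hx => by simp only [h.initial x hx]
  rw [setIntegral_congr_fun measurableSet_Ioi e] at hM₀
  replace hint := hint.congr_fun e measurableSet_Ioi
  have hpow : ∀ x : ℝ, 0 < x → ∀ q : ℝ, 0 ≤ q → q ≤ 4 / 3 → x ^ q ≤ 1 + x ^ (4 / 3 : ℝ) := by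
    intro x hx q hq hq'
    have hp : 0 < x ^ (4 / 3 : ℝ) := by positivity
    rcases le_total x 1 with h1 | h1
    · have := Real.rpow_le_one hx.le h1 hq
      linarith
    · have := Real.rpow_le_rpow_of_exponent_le h1 hq'
      linarith
  refine ⟨?_, ?_, fun R hR => ?_⟩
  · rw [← hM₀]
    refine (h.mass 0 le_rfl).symm.le.trans ?_
    refine setIntegral_mono_on (h.integrable_mass le_rfl) hint measurableSet_Ioi fun x hx => ?_
    refine mul_le_mul_of_nonneg_right ?_ (h.nonneg 0 le_rfl x hx)
    simpa using hpow x hx 1 (by norm_num) (by norm_num)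
  · rw [← hM₀]
    exact setIntegral_mono_on (h.integrable_energy le_rfl) hint measurableSet_Ioi fun x hx =>
      mul_le_mul_of_nonneg_right (hpow x hx _ (by norm_num) (by norm_num))
        (h.nonneg 0 le_rfl x hx)
  · have hf := isLipschitzTest_truncMoment hR
    rw [← hM₀, ← integral_const_mul]
    refine setIntegral_mono_on (h.integrable_mul_slice le_rfl (K := R + 2)
      hf.aemeasurable.aestronglyMeasurable fun x hx => (hf.abs_le hx).trans ?_)
      (hint.const_mul 4) measurableSet_Ioi fun x hx => ?_
    · nlinarith
    · rw [← mul_assoc]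
      exact mul_le_mul_of_nonneg_right ((truncMoment_le hR hx).trans (momentFun_le hx))
        (h.nonneg 0 le_rfl x hx)

/-- Interpolation between the energy `∫ x^{2/3} c`, the mass and the moment `∫ x^{4/3} c`,
applied to a density for which the truncated moments are bounded by `B`. -/
theorem inv_energy_le_of_truncMoment_le (h : IsDiffusiveLSWSolution ε 1 c₀ c L) {T B : ℝ}
    (hT : 0 ≤ T) (hB : ∀ R, 1 ≤ R → ∫ x in Ioi 0, truncMoment R x * c x T ≤ B) :
    1 / lswEnergy c T ≤ B + 4 / 3 := by
  have hslice : ∀ R, 1 ≤ R → IntegrableOn (fun x => truncMoment R x * c x T) (Ioi 0) := by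
    intro R hR
    have hf := isLipschitzTest_truncMoment hR
    refine h.integrable_mul_slice hT (K := R + 2) hf.aemeasurable.aestronglyMeasurable
      fun x hx => (hf.abs_le hx).trans ?_
    nlinarith
  have hn1 : ∀ n : ℕ, (1 : ℝ) ≤ (n : ℝ) + 1 := fun n => by
    have : (0 : ℝ) ≤ n := n.cast_nonneg
    linarith
  have hB0 : 0 ≤ B := le_trans (setIntegral_nonneg measurableSet_Ioi fun x hx =>
    mul_nonneg (truncMoment_nonneg le_rfl hx) (h.nonneg T hT x hx)) (hB 1 le_rfl)
  have hnn : 0 ≤ᵐ[volume.restrict (Ioi 0)] fun x => momentFun x * c x T := by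
    filter_upwards [ae_restrict_mem measurableSet_Ioi] with x hx
    have hx' : 0 < x := hx
    exact mul_nonneg (momentFun_nonneg (by linarith)) (h.nonneg T hT x hx)
  have hmeas : AEStronglyMeasurable (fun x => momentFun x * c x T) (volume.restrict (Ioi 0)) := by
    refine AEStronglyMeasurable.mul (Measurable.aestronglyMeasurable ?_)
      (h.aestronglyMeasurable_slice hT)
    unfold momentFun
    fun_prop
  have hlin : ∫⁻ x in Ioi 0, ENNReal.ofReal (momentFun x * c x T) ≤ ENNReal.ofReal B := by
    calc ∫⁻ x in Ioi 0, ENNReal.ofReal (momentFun x * c x T)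
        = ∫⁻ x in Ioi 0, Filter.liminf (fun n : ℕ =>
            ENNReal.ofReal (truncMoment ((n : ℝ) + 1) x * c x T)) Filter.atTop := by
          refine lintegral_congr fun x => (Filter.Tendsto.liminf_eq ?_).symm
          exact (ENNReal.continuous_ofReal.tendsto _).comp ((tendsto_truncMoment x).mul_const _)
      _ ≤ Filter.liminf (fun n : ℕ => ∫⁻ x in Ioi 0,
            ENNReal.ofReal (truncMoment ((n : ℝ) + 1) x * c x T)) Filter.atTop :=
          lintegral_liminf_le' fun n => (hslice _ (hn1 n)).1.aemeasurable.ennreal_ofReal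
      _ ≤ ENNReal.ofReal B := by
          refine Filter.liminf_le_of_frequently_le' (Filter.Frequently.of_forall fun n => ?_)
          rw [← ofReal_integral_eq_lintegral_ofReal (hslice _ (hn1 n))]
          · exact ENNReal.ofReal_le_ofReal (hB _ (hn1 n))
          · filter_upwards [ae_restrict_mem measurableSet_Ioi] with x hx
            exact mul_nonneg (truncMoment_nonneg (hn1 n) hx) (h.nonneg T hT x hx)
  have hI : IntegrableOn (fun x => momentFun x * c x T) (Ioi 0) :=
    ⟨hmeas, (hasFiniteIntegral_iff_ofReal hnn).2 (hlin.trans_lt ENNReal.ofReal_lt_top)⟩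
  have hIB : ∫ x in Ioi 0, momentFun x * c x T ≤ B := by
    rw [← ofReal_integral_eq_lintegral_ofReal hI hnn] at hlin
    exact (ENNReal.ofReal_le_ofReal_iff hB0).1 hlin
  set e := lswEnergy c T
  have hepos : 0 < e := h.energy_pos hT
  -- Young's inequality with weight `e`, so that the energy term integrates to exactly `1 / 2`.
  have hyoung : ∀ x : ℝ, 0 < x →
      x ≤ 1 / (2 * e) * x ^ (2 / 3 : ℝ) + e / 2 * x ^ (4 / 3 : ℝ) := by
    intro x hx
    have e2 : x ^ (2 / 3 : ℝ) * x ^ (4 / 3 : ℝ) = x ^ 2 := by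
      rw [← Real.rpow_add hx]; norm_num
    have e4 : x ^ (4 / 3 : ℝ) = (x ^ (2 / 3 : ℝ)) ^ 2 := by
      rw [← Real.rpow_mul_natCast hx.le]; norm_num
    have hy : 0 < x ^ (2 / 3 : ℝ) := by positivity
    rw [e4] at e2 ⊢
    set y := x ^ (2 / 3 : ℝ)
    have h1 : 1 / (2 * e) * y + e / 2 * y ^ 2 - x = (y - e * x) ^ 2 / (2 * e * y) := by
      have e5 : 1 / (2 * e) * e = 1 / 2 := by field_simp
      rw [eq_div_iff (by positivity)]
      linear_combination 2 * y ^ 2 * e5 + e ^ 2 * e2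
    have h2 : 0 ≤ (y - e * x) ^ 2 / (2 * e * y) := by positivity
    linarith
  have hE := h.integrable_energy hT
  have hm := h.integrable_mass hT
  have hK : IntegrableOn (fun x => momentFun x * c x T + 4 / 3 * (x * c x T)) (Ioi 0) :=
    hI.add (hm.const_mul _)
  have hmono : ∫ x in Ioi 0, x * c x T ≤ ∫ x in Ioi 0, (1 / (2 * e) * (x ^ (2 / 3 : ℝ) * c x T)
      + e / 2 * (momentFun x * c x T + 4 / 3 * (x * c x T))) := by
    refine setIntegral_mono_on hm ((hE.const_mul _).add (hK.const_mul _))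
      measurableSet_Ioi fun x hx => ?_
    have hc := h.nonneg T hT x hx
    have h1 := hyoung x hx
    have h2 := mul_le_mul_of_nonneg_left (rpow_le_momentFun hx) (by positivity : 0 ≤ e / 2)
    calc x * c x T ≤ (1 / (2 * e) * x ^ (2 / 3 : ℝ)
          + e / 2 * (momentFun x + 4 / 3 * x)) * c x T := by
          gcongr
          linarith
      _ = _ := by ring
  rw [integral_add (hE.const_mul _) (hK.const_mul _), integral_const_mul,
    integral_const_mul, integral_add hI (hm.const_mul _), integral_const_mul, h.mass T hT,
    show ∫ x in Ioi 0, x ^ (2 / 3 : ℝ) * c x T = e from rfl] at hmono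
  have h3 : 1 / (2 * e) * e = 1 / 2 := by field_simp
  have h4 : e / 2 * ((∫ x in Ioi 0, momentFun x * c x T) + 4 / 3 * 1) ≤ e / 2 * (B + 4 / 3) := by
    gcongr
    linarith
  rw [div_le_iff₀ hepos]
  linarith

end IsDiffusiveLSWSolution

/-! ### The coarsening bound -/

/-- If `J ≥ T e²` and `1 / (2e)` is bounded by `8 M + 16 J`, then `J³ ≳ T` as soon as
`T ≥ M³`. -/
theorem le_cube_of_bounds {T M e J : ℝ} (hM : 1 ≤ M) (hT : M ^ 3 ≤ T) (he : 0 < e)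
    (h1 : T * e ^ 2 ≤ J) (h2 : 1 / (2 * e) ≤ 8 * M + 16 * J) : T ≤ 2 ^ 30 * J ^ 3 := by
  have hM3 : 1 ≤ M ^ 3 := one_le_pow₀ hM
  have hT0 : 0 < T := by linarith
  have hJ : 0 < J := lt_of_lt_of_le (by positivity) h1
  have h2' : 1 ≤ 16 * M * e + 32 * J * e := by
    rw [div_le_iff₀ (by positivity)] at h2
    linarith
  rcases le_total (32 * M * e) 1 with h | h
  · have h3 : 1 ≤ 64 * J * e := by linarith
    have h4 : 1 ≤ (64 * J * e) ^ 2 := one_le_pow₀ h3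
    calc T = T * 1 := (mul_one T).symm
      _ ≤ T * (64 * J * e) ^ 2 := by gcongr
      _ = 4096 * J ^ 2 * (T * e ^ 2) := by ring
      _ ≤ 4096 * J ^ 2 * J := by gcongr
      _ ≤ 2 ^ 30 * J ^ 3 := by nlinarith [pow_pos hJ 3]
  · have h4 : 1 ≤ (32 * M * e) ^ 6 := one_le_pow₀ h
    have h5 : (M ^ 3) ^ 2 ≤ T ^ 2 := by gcongr
    calc T = T * 1 := (mul_one T).symm
      _ ≤ T * (32 * M * e) ^ 6 := by gcongr
      _ = 2 ^ 30 * T * e ^ 6 * (M ^ 3) ^ 2 := by ring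
      _ ≤ 2 ^ 30 * T * e ^ 6 * T ^ 2 := by gcongr
      _ = 2 ^ 30 * (T * e ^ 2) ^ 3 := by ring
      _ ≤ 2 ^ 30 * J ^ 3 := by gcongr

theorem theorem3p2 :
    ∃ K₁ K₂ : ℝ, 0 < K₁ ∧ 0 < K₂ ∧
      ∀ (ε : ℝ), 0 < ε → ε ≤ 1 →
      ∀ (c₀ : ℝ → ℝ) (M₀ : ℝ),
        (∀ x, 0 < x → 0 ≤ c₀ x) →
        IntegrableOn (fun x => (1 + x ^ (4 / 3 : ℝ)) * c₀ x) (Ioi 0) →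
        ∫ x in Ioi 0, (1 + x ^ (4 / 3 : ℝ)) * c₀ x = M₀ →
      ∀ (c : ℝ → ℝ → ℝ) (L : ℝ → ℝ), IsDiffusiveLSWSolution ε 1 c₀ c L →
      ∀ T : ℝ, K₂ * M₀ ^ 3 ≤ T →
        IntervalIntegrable (fun t => lswEnergy c t ^ 2) volume 0 T ∧
        ((1 / T) * ∫ t in (0 : ℝ)..T, lswEnergy c t ^ 2) ^ (-(3 / 2) : ℝ) ≤ K₁ * T := by
  refine ⟨2 ^ 15, 1, by norm_num, one_pos, ?_⟩
  intro ε hε hε1 c₀ M₀ _ hint hM₀ c L h T hT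
  rw [one_mul] at hT
  obtain ⟨hM1, hE0, hH0⟩ := h.moment_bounds_initial hint hM₀
  have hT0 : 0 < T := by
    have : 1 ≤ M₀ ^ 3 := one_le_pow₀ hM1
    linarith
  refine ⟨h.intervalIntegrable_energy_sq hε hε1 hT0.le, ?_⟩
  have hJ1 := h.mul_energy_sq_le hε hε1 hT0.le
  have hinv := h.inv_energy_le_of_truncMoment_le hT0.le
    (B := 1 / (2 * lswEnergy c T) + 6 * M₀ + 16 * ∫ t in (0 : ℝ)..T, lswEnergy c t ^ 2) (by
      intro R hR
      have h1 := h.truncMoment_growth hε hε1 hT0.le hR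
      have h2 := hH0 R hR
      linarith)
  have he := h.energy_pos hT0.le
  set e := lswEnergy c T
  set J := ∫ t in (0 : ℝ)..T, lswEnergy c t ^ 2
  have hhalf : 1 / e = 1 / (2 * e) + 1 / (2 * e) := by field_simp; norm_num
  have hcube := le_cube_of_bounds hM1 hT he hJ1 (by linarith)
  have hJ : 0 < J := lt_of_lt_of_le (by positivity) hJ1
  have hA : 0 < 1 / T * J := by positivity
  have hsq : ((1 / T * J) ^ (3 / 2 : ℝ)) ^ 2 = (1 / T * J) ^ 3 := by
    rw [← Real.rpow_mul_natCast hA.le]; norm_num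
  rw [Real.rpow_neg hA.le]
  have hlow : 1 / (2 ^ 15 * T) ≤ (1 / T * J) ^ (3 / 2 : ℝ) := by
    refine le_of_sq_le_sq ?_ (by positivity)
    rw [hsq]
    calc (1 / (2 ^ 15 * T)) ^ 2 = T / (2 ^ 30 * T ^ 3) := by
          field_simp
      _ ≤ (2 ^ 30 * J ^ 3) / (2 ^ 30 * T ^ 3) := by gcongr
      _ = (1 / T * J) ^ 3 := by field_simp
  calc ((1 / T * J) ^ (3 / 2 : ℝ))⁻¹ ≤ (1 / (2 ^ 15 * T))⁻¹ := by gcongr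
    _ = 2 ^ 15 * T := by rw [one_div, inv_inv]
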